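/- Write $e(y)=e^{2\pi i y}$ and let $$F(x)=\sum_{n=1}^\infty \frac{e(n^2x)}{n},$$ the series being summed in its natural order; it converges for almost every $x$ and $F$ is integrable on $[0,1)$. For a finite continued fraction $p/q=[0;a_1,\dots,a_j]$ (with $j\ge 0$, positive integers $a_i$, and $p/q$ in lowest terms with $q\ge 1$) let $I_{p/q}$ be the set of $x\in[0,1)$ of the form $x=[0;a_1,\dots,a_j,\dots]$, that is, whose $j$-th convergent is $p/q$; if $p/q$ has two such expansions (of different lengths $j$), either of them may be chosen. Then there is an absolute constant $C>0$ such that for every such $p/q$, either choice of its expansion, every interval $I\subset I_{p/q}$ and every $\lambda>0$, $$\big|\{x\in I : |F(x)-F_I|>\lambda\}\big|\le C\,|I|\,e^{-\lambda\sqrt{2q}},$$ where $|\cdot|$ denotes Lebesgue measure and $F_I=|I|^{-1}\int_I F$ is the average of $F$ on $I$. -/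

import Mathlib

open MeasureTheory Filter Topology

noncomputable section

/-- The partial sum `∑_{n = 1}^{N} e(n² x) / n`, where `e(y) = exp(2πi y)`. -/
def squareSeriesPartial (N : ℕ) (x : ℝ) : ℂ :=
  ∑ n ∈ Finset.Icc 1 N,
    Complex.exp (2 * Real.pi * Complex.I * ((n : ℂ) ^ 2 * (x : ℂ))) / (n : ℂ)

/-- The function `F(x) = ∑_{n ≥ 1} e(n² x) / n`: the limit of the partial sums in their natural
order (the series is not absolutely convergent, so `∑'` would not be the right notion).
The value is meaningful at the points where the series converges. -/
def squareSeries (x : ℝ) : ℂ :=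
  limUnder atTop (fun N : ℕ => squareSeriesPartial N x)

/-- The interval `I_{p/q}`, for the choice `j` of the length of the continued fraction
`p/q = [0; a₁, …, a_j]`: the numbers `x = [0; a₁, …, a_j, …]` of `[0, 1)`, that is, those whose
`j`-th convergent is `p/q`. (A rational number has at most two finite continued fractions, of
different lengths, with integer part `0` and positive `aᵢ`, so `p/q` and `j` determine `a₁, …, a_j`. If `p/q` has no continued fraction
`[0; a₁, …, a_j]` of length `j`, then the set has at most one point.) -/
def convergentInterval (p q j : ℕ) : Set ℝ :=
  {x : ℝ | x ∈ Set.Ico (0 : ℝ) 1 ∧ (GenContFract.of x).convs j = (p : ℝ) / (q : ℝ)}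

end

/-! ### The theta function near a rational point -/

/-- The theta series `∑_{n ∈ ℤ} e(n² z)`. -/
noncomputable def squareTheta (z : ℂ) : ℂ := jacobiTheta (2 * z)

lemma ZMod.card_filter_two_mul_eq_zero_le (q : ℕ) [NeZero q] :
    (Finset.univ.filter fun d : ZMod q => 2 * d = 0).card ≤ 2 := by
  have h : (Finset.univ.filter fun d : ZMod q => 2 * d = 0) ⊆
      {(0 : ZMod q), ((q / 2 : ℕ) : ZMod q)} := by
    intro d hd
    simp only [Finset.mem_filter, Finset.mem_univ, true_and] at hd
    have h1 : ((2 * d.val : ℕ) : ZMod q) = 0 := by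
      push_cast
      rw [ZMod.natCast_val, ZMod.cast_id]
      exact hd
    rw [ZMod.natCast_eq_zero_iff] at h1
    obtain ⟨k, hk⟩ := h1
    have hlt := ZMod.val_lt d
    have hk2 : k < 2 := by
      by_contra! hc
      have : q * 2 ≤ q * k := Nat.mul_le_mul_left _ hc
      omega
    simp only [Finset.mem_insert, Finset.mem_singleton]
    interval_cases k
    · left
      have : d.val = 0 := by omega
      rwa [ZMod.val_eq_zero] at this
    · right
      have : q / 2 = d.val := by omega
      rw [this, ZMod.natCast_val, ZMod.cast_id]
  exact (Finset.card_le_card h).trans Finset.card_le_two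

lemma ZMod.norm_quadratic_gauss_sum_le (q : ℕ) [NeZero q] (a m : ZMod q) (ha : IsUnit a) :
    ‖∑ x : ZMod q, ZMod.stdAddChar (a * x ^ 2 + m * x)‖ ≤ Real.sqrt (2 * q) := by
  set ψ : AddChar (ZMod q) ℂ := ZMod.stdAddChar with hψ
  set G := ∑ x : ZMod q, ψ (a * x ^ 2 + m * x) with hG
  have h1 : G * (starRingEnd ℂ) G
      = ∑ d : ZMod q, ψ (a * d ^ 2 + m * d) * ∑ y : ZMod q, ψ (y * (2 * a * d)) := by
    calc G * (starRingEnd ℂ) G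
        = ∑ y : ZMod q, ∑ x : ZMod q, ψ (a * x ^ 2 + m * x) * ψ (-(a * y ^ 2 + m * y)) := by
          rw [hG, map_sum, Finset.sum_mul_sum, Finset.sum_comm]
          simp_rw [AddChar.map_neg_eq_conj]
      _ = ∑ y : ZMod q, ∑ d : ZMod q, ψ (a * d ^ 2 + m * d) * ψ (y * (2 * a * d)) := by
          refine Finset.sum_congr rfl fun y _ => ?_
          rw [← Equiv.sum_comp (Equiv.addLeft y)]
          refine Finset.sum_congr rfl fun d _ => ?_
          rw [← AddChar.map_add_eq_mul, ← AddChar.map_add_eq_mul]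
          congr 1
          simp only [Equiv.coe_addLeft]
          ring
      _ = _ := by
          rw [Finset.sum_comm]
          simp_rw [Finset.mul_sum]
  have h2 : ‖G * (starRingEnd ℂ) G‖ ≤ 2 * q := by
    rw [h1]
    calc _ ≤ ∑ d : ZMod q, (if 2 * d = 0 then (q : ℝ) else 0) := by
          refine (norm_sum_le _ _).trans (Finset.sum_le_sum fun d _ => ?_)
          rw [norm_mul, AddChar.norm_apply, one_mul,
            AddChar.sum_mulShift _ (ZMod.isPrimitive_stdAddChar q), ZMod.card]
          have : 2 * a * d = 0 ↔ 2 * d = 0 := by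
            rw [show 2 * a * d = a * (2 * d) by ring]
            exact ha.mul_right_eq_zero
          simp only [this]
          split_ifs <;> simp
      _ = (Finset.univ.filter fun d : ZMod q => 2 * d = 0).card * (q : ℝ) := by
          rw [← Finset.sum_filter, Finset.sum_const, nsmul_eq_mul]
      _ ≤ 2 * q := by
          gcongr
          exact_mod_cast ZMod.card_filter_two_mul_eq_zero_le q
  rw [norm_mul, RCLike.norm_conj, ← sq] at h2
  exact Real.le_sqrt_of_sq_le h2

/-- The real theta series `∑_{m ∈ ℤ} exp (-π m² w / 2)`. -/
noncomputable def gaussTheta (w : ℝ) : ℝ := ∑' m : ℤ, Real.exp (-Real.pi * (w / 2) * (m : ℝ) ^ 2)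

lemma summable_exp_neg_mul_int_sq {a : ℝ} (ha : 0 < a) :
    Summable fun m : ℤ => Real.exp (-Real.pi * a * (m : ℝ) ^ 2) := by
  have h := ((summable_jacobiTheta₂_term_iff 0 (Complex.I * a)).2 (by simpa using ha)).norm
  refine h.congr fun m => ?_
  rw [norm_jacobiTheta₂_term]
  simp
  ring

lemma norm_exp_pi_div (q : ℕ) (τ : ℂ) (m : ℤ) :
    ‖Complex.exp (Real.pi * Complex.I * (m : ℂ) ^ 2 * (-1 / (2 * (q : ℂ) ^ 2 * τ)))‖ =
      Real.exp (-Real.pi * ((τ.im / ((q : ℝ) ^ 2 * ‖τ‖ ^ 2)) / 2) * (m : ℝ) ^ 2) := by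
  have him : (-1 / (2 * (q : ℂ) ^ 2 * τ)).im = (τ.im / ((q : ℝ) ^ 2 * ‖τ‖ ^ 2)) / 2 := by
    have : (-1 / (2 * (q : ℂ) ^ 2 * τ)) = ((-1 / (2 * (q : ℝ) ^ 2) : ℝ) : ℂ) * τ⁻¹ := by
      push_cast
      rw [div_mul_eq_div_div, div_eq_mul_inv _ τ]
    rw [this, Complex.im_ofReal_mul, Complex.inv_im, Complex.normSq_eq_norm_sq]
    ring
  rw [Complex.norm_exp]
  congr 1
  rw [← him]
  have : (Real.pi * Complex.I * (m : ℂ) ^ 2 * (-1 / (2 * (q : ℂ) ^ 2 * τ))) =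
    ((Real.pi * (m : ℝ) ^ 2 : ℝ) : ℂ) * ((-1 / (2 * (q : ℂ) ^ 2 * τ)) * Complex.I) := by
    push_cast; ring
  rw [this, Complex.re_ofReal_mul, Complex.mul_I_re]
  ring

lemma squareTheta_rat_add (q : ℕ) [NeZero q] (p : ℤ) {τ : ℂ} (hτ : 0 < τ.im) :
    squareTheta (p / q + τ) = 1 / (-Complex.I * (2 * (q : ℂ) ^ 2 * τ)) ^ (1 / 2 : ℂ) *
      ∑' m : ℤ, (∑ x : ZMod q, ZMod.stdAddChar ((p : ZMod q) * x ^ 2 + (m : ZMod q) * x)) *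
        Complex.exp (Real.pi * Complex.I * (m : ℂ) ^ 2 * (-1 / (2 * (q : ℂ) ^ 2 * τ))) := by
  have hq0 : (q : ℂ) ≠ 0 := by exact_mod_cast NeZero.ne q
  have hqpos : (0 : ℝ) < q := by exact_mod_cast Nat.pos_of_neZero q
  have hτ0 : τ ≠ 0 := by rintro rfl; simp at hτ
  have hbij : Function.Bijective (fun r : Fin q => ((r : ℕ) : ZMod q)) := by
    rw [Fintype.bijective_iff_injective_and_card]
    refine ⟨fun r s h => ?_, by simp [ZMod.card]⟩
    have h' : ((r : ℕ) : ZMod q) = ((s : ℕ) : ZMod q) := h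
    rw [ZMod.natCast_eq_natCast_iff', Nat.mod_eq_of_lt r.2, Nat.mod_eq_of_lt s.2] at h'
    exact Fin.ext h'
  have him2 : 0 < (2 * (q : ℂ) ^ 2 * τ).im := by
    have : (2 * (q : ℂ) ^ 2 * τ) = ((2 * (q : ℝ) ^ 2 : ℝ) : ℂ) * τ := by push_cast; ring
    rw [this, Complex.im_ofReal_mul]
    positivity
  have hsum : Summable fun n : ℤ =>
      Complex.exp (Real.pi * Complex.I * (n : ℂ) ^ 2 * (2 * (p / q + τ))) := by
    have h := (summable_jacobiTheta₂_term_iff 0 (2 * ((p : ℂ) / q + τ))).2 (by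
      have : (2 * ((p : ℂ) / q + τ)) = ((2 * ((p : ℝ) / q) : ℝ) : ℂ) + ((2 : ℝ) : ℂ) * τ := by
        push_cast; ring
      rw [this, Complex.add_im, Complex.ofReal_im, Complex.im_ofReal_mul]
      linarith)
    refine h.congr fun n => ?_
    simp [jacobiTheta₂_term]
  -- the sum over one residue class
  have hclass : ∀ r : Fin q, ∑' l : ℤ,
      Complex.exp (Real.pi * Complex.I * ((l * q + (r : ℕ) : ℤ) : ℂ) ^ 2 * (2 * (p / q + τ))) =
      ∑' m : ℤ, 1 / (-Complex.I * (2 * (q : ℂ) ^ 2 * τ)) ^ (1 / 2 : ℂ) *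
        (ZMod.stdAddChar ((p : ZMod q) * ((r : ℕ) : ZMod q) ^ 2 + (m : ZMod q) * ((r : ℕ) : ZMod q))
        * Complex.exp (Real.pi * Complex.I * (m : ℂ) ^ 2 * (-1 / (2 * (q : ℂ) ^ 2 * τ)))) := by
    intro r
    have e1 : ∀ l : ℤ,
        Complex.exp (Real.pi * Complex.I * ((l * q + (r : ℕ) : ℤ) : ℂ) ^ 2 * (2 * (p / q + τ))) =
        (ZMod.stdAddChar ((p : ZMod q) * ((r : ℕ) : ZMod q) ^ 2) *
          Complex.exp (2 * Real.pi * Complex.I * (r : ℕ) ^ 2 * τ)) *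
          jacobiTheta₂_term l (2 * (r : ℕ) * q * τ) (2 * (q : ℂ) ^ 2 * τ) := by
      intro l
      have : (p : ZMod q) * ((r : ℕ) : ZMod q) ^ 2 = ((p * (l * q + (r : ℕ)) ^ 2 : ℤ) : ZMod q) := by
        push_cast
        simp
      rw [this, ZMod.stdAddChar_coe, jacobiTheta₂_term, ← Complex.exp_add, ← Complex.exp_add]
      congr 1
      push_cast
      field_simp
      ring
    simp_rw [e1]
    rw [tsum_mul_left, ← jacobiTheta₂, jacobiTheta₂_functional_equation, jacobiTheta₂,
      tsum_mul_left]
    simp_rw [AddChar.map_add_eq_mul]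
    rw [show ∀ A B C D E : ℂ, A * B * (C * D * E) = C * (A * (B * D * E)) by intros; ring]
    congr 1
    simp_rw [mul_assoc]
    rw [tsum_mul_left]
    congr 1
    rw [← mul_assoc, ← Complex.exp_add, ← tsum_mul_left]
    refine tsum_congr fun m => ?_
    have : (m : ZMod q) * ((r : ℕ) : ZMod q) = ((m * (r : ℕ) : ℤ) : ZMod q) := by push_cast; rfl
    rw [this, ZMod.stdAddChar_coe, jacobiTheta₂_term, ← Complex.exp_add, ← Complex.exp_add]
    congr 1
    push_cast
    field_simp
    ring
  have hsumG : ∀ r : Fin q, Summable fun m : ℤ =>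
      1 / (-Complex.I * (2 * (q : ℂ) ^ 2 * τ)) ^ (1 / 2 : ℂ) *
        (ZMod.stdAddChar ((p : ZMod q) * ((r : ℕ) : ZMod q) ^ 2 + (m : ZMod q) * ((r : ℕ) : ZMod q))
        * Complex.exp (Real.pi * Complex.I * (m : ℂ) ^ 2 * (-1 / (2 * (q : ℂ) ^ 2 * τ)))) := by
    intro r
    refine Summable.mul_left _ (Summable.of_norm ?_)
    have hw : 0 < (τ.im / ((q : ℝ) ^ 2 * ‖τ‖ ^ 2)) / 2 := by
      have : 0 < ‖τ‖ := norm_pos_iff.2 hτ0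
      positivity
    refine (summable_exp_neg_mul_int_sq hw).congr fun m => ?_
    rw [norm_mul, AddChar.norm_apply, one_mul, norm_exp_pi_div]
  rw [squareTheta, jacobiTheta, ← Equiv.tsum_eq (Int.divModEquiv q).symm,
    ← Equiv.tsum_eq (Equiv.prodComm (Fin q) ℤ)]
  rw [Summable.tsum_prod]
  · rw [tsum_fintype]
    simp only [Equiv.prodComm_apply, Prod.swap_prod_mk, Int.divModEquiv_symm_apply]
    rw [Finset.sum_congr rfl fun r _ => hclass r, ← Summable.tsum_finsetSum fun r _ => hsumG r,
      ← tsum_mul_left]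
    refine tsum_congr fun m => ?_
    rw [← Finset.mul_sum, ← Finset.sum_mul]
    congr 2
    exact hbij.sum_comp (fun x : ZMod q => ZMod.stdAddChar ((p : ZMod q) * x ^ 2 + (m : ZMod q) * x))
  · have := (Equiv.summable_iff (((Equiv.prodComm (Fin q) ℤ)).trans (Int.divModEquiv q).symm)).2 hsum
    exact this

/-- The size of the theta function near a rational point. -/
lemma norm_squareTheta_rat_add_le (q : ℕ) [NeZero q] (p : ℤ) (hpq : IsCoprime p (q : ℤ)) {τ : ℂ}
    (hτ : 0 < τ.im) :
    ‖squareTheta (p / q + τ)‖ ≤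
      1 / Real.sqrt (q * ‖τ‖) * gaussTheta (τ.im / ((q : ℝ) ^ 2 * ‖τ‖ ^ 2)) := by
  have hqpos : (0 : ℝ) < q := by exact_mod_cast Nat.pos_of_neZero q
  have hτ0 : τ ≠ 0 := by rintro rfl; simp at hτ
  have hn : 0 < ‖τ‖ := norm_pos_iff.2 hτ0
  have hw : 0 < (τ.im / ((q : ℝ) ^ 2 * ‖τ‖ ^ 2)) / 2 := by positivity
  have hunit : IsUnit (p : ZMod q) := (ZMod.coe_int_isUnit_iff_isCoprime p q).2 hpq.symm
  rw [squareTheta_rat_add q p hτ, norm_mul]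
  have hK : ‖1 / (-Complex.I * (2 * (q : ℂ) ^ 2 * τ)) ^ (1 / 2 : ℂ)‖ =
      1 / Real.sqrt (2 * q ^ 2 * ‖τ‖) := by
    rw [norm_div, norm_one, show (1 / 2 : ℂ) = ((1 / 2 : ℝ) : ℂ) by push_cast; rfl,
      Complex.norm_cpow_real, ← Real.sqrt_eq_rpow]
    congr 2
    simp
  have hS : ‖∑' m : ℤ,
      (∑ x : ZMod q, ZMod.stdAddChar ((p : ZMod q) * x ^ 2 + (m : ZMod q) * x)) *
        Complex.exp (Real.pi * Complex.I * (m : ℂ) ^ 2 * (-1 / (2 * (q : ℂ) ^ 2 * τ)))‖ ≤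
      Real.sqrt (2 * q) * gaussTheta (τ.im / ((q : ℝ) ^ 2 * ‖τ‖ ^ 2)) := by
    rw [gaussTheta, ← tsum_mul_left]
    refine tsum_of_norm_bounded
      ((summable_exp_neg_mul_int_sq hw).mul_left _).hasSum fun m => ?_
    rw [norm_mul, norm_exp_pi_div]
    gcongr
    exact ZMod.norm_quadratic_gauss_sum_le q _ _ hunit
  rw [hK]
  calc _ ≤ 1 / Real.sqrt (2 * q ^ 2 * ‖τ‖) *
        (Real.sqrt (2 * q) * gaussTheta (τ.im / ((q : ℝ) ^ 2 * ‖τ‖ ^ 2))) := by gcongr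
    _ = _ := by
      rw [show (2 * q ^ 2 * ‖τ‖ : ℝ) = (2 * q) * (q * ‖τ‖) by ring,
        Real.sqrt_mul (by positivity : (0 : ℝ) ≤ 2 * q)]
      have : Real.sqrt (2 * q) ≠ 0 := by positivity
      field_simp

lemma gaussTheta_nonneg (w : ℝ) : 0 ≤ gaussTheta w := tsum_nonneg fun _ => (Real.exp_pos _).le

lemma gaussTheta_le_one_add {w : ℝ} (hw : 0 < w) : gaussTheta w ≤ 1 + 3 / w := by
  have him : (Complex.I * ((w / 2 : ℝ) : ℂ)).im = w / 2 := by simp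
  have hpos : 0 < (Complex.I * ((w / 2 : ℝ) : ℂ)).im := by rw [him]; positivity
  have heq : (gaussTheta w : ℂ) = jacobiTheta (Complex.I * ((w / 2 : ℝ) : ℂ)) := by
    rw [gaussTheta, jacobiTheta, Complex.ofReal_tsum]
    refine tsum_congr fun m => ?_
    rw [Complex.ofReal_exp]
    congr 1
    push_cast
    linear_combination -(Real.pi : ℂ) * (w / 2) * m ^ 2 * Complex.I_sq
  have h := norm_jacobiTheta_sub_one_le hpos
  rw [← heq, him] at h
  have h1 : gaussTheta w - 1 ≤ ‖(gaussTheta w : ℂ) - 1‖ := by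
    rw [show (gaussTheta w : ℂ) - 1 = ((gaussTheta w - 1 : ℝ) : ℂ) by push_cast; rfl,
      Complex.norm_real]
    exact le_abs_self _
  have hu : 0 < Real.pi * (w / 2) := by positivity
  have h2 : 2 / (1 - Real.exp (-Real.pi * (w / 2))) * Real.exp (-Real.pi * (w / 2)) ≤ 3 / w := by
    have e1 : Real.exp (-Real.pi * (w / 2)) < 1 := by
      rw [Real.exp_lt_one_iff]; linarith
    have e2 := Real.add_one_le_exp (Real.pi * (w / 2))
    have e3 : Real.exp (-Real.pi * (w / 2)) * Real.exp (Real.pi * (w / 2)) = 1 := by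
      rw [← Real.exp_add]; simp
    rw [div_mul_eq_mul_div, div_le_div_iff₀ (by linarith) hw]
    have e4 := Real.exp_pos (-Real.pi * (w / 2))
    have e5 : Real.exp (-Real.pi * (w / 2)) * (Real.pi * (w / 2) + 1) ≤ 1 := by
      calc _ ≤ Real.exp (-Real.pi * (w / 2)) * Real.exp (Real.pi * (w / 2)) := by gcongr
        _ = 1 := e3
    nlinarith [Real.pi_gt_three, mul_pos e4 hw]
  linarith

lemma gaussTheta_le_sqrt {w : ℝ} (hw : 0 < w) : gaussTheta w ≤ 3 + 6 / Real.sqrt w := by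
  rcases le_total 2 w with h2 | h2
  · have := gaussTheta_le_one_add hw
    have h3 : 3 / w ≤ 2 := by rw [div_le_iff₀ hw]; linarith
    have : 0 ≤ 6 / Real.sqrt w := by positivity
    linarith
  · have h := Real.tsum_exp_neg_mul_int_sq (a := w / 2) (by positivity)
    have h4 : ∑' n : ℤ, Real.exp (-Real.pi / (w / 2) * (n : ℝ) ^ 2) = gaussTheta (4 / w) := by
      rw [gaussTheta]
      refine tsum_congr fun m => ?_
      congr 2
      field_simp
      norm_num
    rw [h4, ← gaussTheta] at h
    rw [h, ← Real.sqrt_eq_rpow]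
    have h5 := gaussTheta_le_one_add (w := 4 / w) (by positivity)
    have h6 : 3 / (4 / w) ≤ 3 / 2 := by
      rw [div_div_eq_mul_div]; linarith
    have hs : 0 < Real.sqrt w := by positivity
    have h7 : 1 / Real.sqrt (w / 2) ≤ 2 / Real.sqrt w := by
      rw [Real.sqrt_div hw.le, one_div_div]
      gcongr
      rw [Real.sqrt_le_left (by norm_num)]
      norm_num
    calc _ ≤ 2 / Real.sqrt w * (5 / 2) := by
          gcongr
          · exact gaussTheta_nonneg _
          · linarith
      _ ≤ 3 + 6 / Real.sqrt w := by
          have : 0 < 1 / Real.sqrt w := by positivity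
          have e : 2 / Real.sqrt w * (5 / 2) = 5 * (1 / Real.sqrt w) := by ring
          have e' : 6 / Real.sqrt w = 6 * (1 / Real.sqrt w) := by ring
          rw [e, e']
          linarith

/-! ### The square series as an integral of the theta function -/

/-- The exponential `e(n² z)`. -/
noncomputable def squareExp (n : ℕ) (z : ℂ) : ℂ :=
  Complex.exp (2 * Real.pi * Complex.I * ((n : ℂ) ^ 2 * z))

/-- The tail `2 ∑_{n > N} e(n² z)` of the theta series. -/
noncomputable def thetaTail (N : ℕ) (z : ℂ) : ℂ :=
  squareTheta z - 1 - 2 * ∑ n ∈ Finset.Icc 1 N, squareExp n z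

lemma hasSum_thetaTail (N : ℕ) {z : ℂ} (hz : 0 < z.im) :
    HasSum (fun n : ℕ => 2 * squareExp (n + N + 1) z) (thetaTail N z) := by
  have hz2 : 0 < (2 * z).im := by simpa using hz
  have h := ((hasSum_nat_add_iff' N).2 (hasSum_nat_jacobiTheta hz2)).mul_left 2
  have hsum : ∑ i ∈ Finset.range N, Complex.exp (Real.pi * Complex.I * ((i : ℂ) + 1) ^ 2 * (2 * z))
      = ∑ n ∈ Finset.Icc 1 N, squareExp n z := by
    rw [Finset.range_eq_Ico, ← Finset.Ico_add_one_right_eq_Icc,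
      ← Finset.sum_Ico_add' (fun n : ℕ => squareExp n z) 0 N 1]
    refine Finset.sum_congr rfl fun n _ => ?_
    rw [squareExp]
    congr 1
    push_cast
    ring
  rw [hsum] at h
  have e1 : (fun n : ℕ => 2 * squareExp (n + N + 1) z) = fun i : ℕ =>
      2 * Complex.exp (Real.pi * Complex.I * (((i + N : ℕ) : ℂ) + 1) ^ 2 * (2 * z)) := by
    funext n
    rw [squareExp]
    congr 2
    push_cast
    ring
  have e2 : thetaTail N z =
      2 * ((jacobiTheta (2 * z) - 1) / 2 - ∑ n ∈ Finset.Icc 1 N, squareExp n z) := by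
    simp only [thetaTail, squareTheta]
    ring
  rw [e1, e2]
  exact h

lemma squareExp_add_mul_I (n : ℕ) (x y : ℝ) :
    squareExp n (x + y * Complex.I) =
      (Real.exp (-(2 * Real.pi * (n : ℝ) ^ 2 * y)) : ℂ) * squareExp n x := by
  rw [squareExp, squareExp, Complex.ofReal_exp, ← Complex.exp_add]
  congr 1
  push_cast
  linear_combination (2 * Real.pi * (n : ℂ) ^ 2 * y) * Complex.I_sq

lemma norm_squareExp_ofReal (n : ℕ) (x : ℝ) : ‖squareExp n x‖ = 1 := by
  rw [squareExp, show (2 * Real.pi * Complex.I * ((n : ℂ) ^ 2 * (x : ℂ))) =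
    ((2 * Real.pi * ((n : ℝ) ^ 2 * x) : ℝ) : ℂ) * Complex.I by push_cast; ring,
    Complex.norm_exp_ofReal_mul_I]

lemma continuous_squareExp (n : ℕ) : Continuous (squareExp n) := by
  unfold squareExp
  fun_prop

lemma integral_squareExp_mul_conj (a : ℝ) (n m : ℕ) :
    ∫ x in a..a + 1, squareExp n x * (starRingEnd ℂ) (squareExp m x) = if n = m then 1 else 0 := by
  have h : ∀ x : ℝ, squareExp n x * (starRingEnd ℂ) (squareExp m x) =
      Complex.exp ((2 * Real.pi * Complex.I * (((n : ℤ) ^ 2 - (m : ℤ) ^ 2 : ℤ) : ℂ)) * x) := by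
    intro x
    rw [squareExp, squareExp, ← Complex.exp_conj, ← Complex.exp_add]
    congr 1
    simp only [map_mul, map_pow, Complex.conj_I, Complex.conj_ofReal, map_natCast, map_ofNat]
    push_cast
    ring
  simp_rw [h]
  split_ifs with hnm
  · subst hnm
    simp
  · have hne : ((n : ℤ) ^ 2 - (m : ℤ) ^ 2 : ℤ) ≠ 0 := by
      intro h0
      have h1 : (n : ℤ) ^ 2 = (m : ℤ) ^ 2 := by linarith
      exact hnm (by
        have := (pow_left_inj₀ (Int.natCast_nonneg n) (Int.natCast_nonneg m) two_ne_zero).1 h1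
        exact_mod_cast this)
    have hc : (2 * Real.pi * Complex.I * (((n : ℤ) ^ 2 - (m : ℤ) ^ 2 : ℤ) : ℂ)) ≠ 0 := by
      refine mul_ne_zero Complex.two_pi_I_ne_zero ?_
      exact_mod_cast hne
    rw [integral_exp_mul_complex hc]
    have : Complex.exp ((2 * Real.pi * Complex.I * (((n : ℤ) ^ 2 - (m : ℤ) ^ 2 : ℤ) : ℂ)) *
        ((a + 1 : ℝ) : ℂ)) =
        Complex.exp ((2 * Real.pi * Complex.I * (((n : ℤ) ^ 2 - (m : ℤ) ^ 2 : ℤ) : ℂ)) * a) := by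
      rw [Complex.exp_eq_exp_iff_exists_int]
      refine ⟨(n : ℤ) ^ 2 - (m : ℤ) ^ 2, ?_⟩
      push_cast
      ring
    rw [this, sub_self, zero_div]

lemma integral_norm_sq_sum_squareExp (a : ℝ) (s : Finset ℕ) (c : ℕ → ℂ) :
    ∫ x in a..a + 1, ‖∑ n ∈ s, c n * squareExp n x‖ ^ 2 = ∑ n ∈ s, ‖c n‖ ^ 2 := by
  have hcont : ∀ n : ℕ, Continuous fun x : ℝ => squareExp n x := fun n =>
    (continuous_squareExp n).comp Complex.continuous_ofReal
  have h : ∀ x : ℝ, ((‖∑ n ∈ s, c n * squareExp n x‖ ^ 2 : ℝ) : ℂ) =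
      ∑ n ∈ s, ∑ m ∈ s, (c n * (starRingEnd ℂ) (c m)) *
        (squareExp n x * (starRingEnd ℂ) (squareExp m x)) := by
    intro x
    rw [Complex.ofReal_pow, ← Complex.mul_conj', map_sum, Finset.sum_mul_sum]
    refine Finset.sum_congr rfl fun n _ => Finset.sum_congr rfl fun m _ => ?_
    rw [map_mul]
    ring
  have hint : ∀ n m : ℕ, IntervalIntegrable (fun x : ℝ => (c n * (starRingEnd ℂ) (c m)) *
        (squareExp n x * (starRingEnd ℂ) (squareExp m x))) volume a (a + 1) := fun n m =>
    Continuous.intervalIntegrable (continuous_const.mul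
      ((hcont n).mul (Complex.continuous_conj.comp (hcont m)))) _ _
  apply Complex.ofReal_injective
  rw [← intervalIntegral.integral_ofReal]
  simp_rw [h]
  have hint' : ∀ n ∈ s, IntervalIntegrable (fun x : ℝ => ∑ m ∈ s,
      (c n * (starRingEnd ℂ) (c m)) * (squareExp n x * (starRingEnd ℂ) (squareExp m x)))
      volume a (a + 1) := fun n _ => Continuous.intervalIntegrable
    (continuous_finsetSum _ fun m _ => continuous_const.mul
      ((hcont n).mul (Complex.continuous_conj.comp (hcont m)))) _ _
  rw [intervalIntegral.integral_finsetSum hint']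
  rw [Complex.ofReal_sum]
  refine Finset.sum_congr rfl fun n hn => ?_
  rw [intervalIntegral.integral_finsetSum fun m _ => hint n m]
  simp_rw [intervalIntegral.integral_const_mul, integral_squareExp_mul_conj]
  simp only [mul_ite, mul_one, mul_zero, Finset.sum_ite_eq, hn, if_true]
  rw [Complex.mul_conj', Complex.ofReal_pow]

lemma differentiableAt_squareTheta {z : ℂ} (hz : 0 < z.im) : DifferentiableAt ℂ squareTheta z := by
  have hz2 : 0 < (2 * z).im := by simpa using hz
  exact (differentiableAt_jacobiTheta hz2).comp z (by fun_prop)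

lemma continuousOn_squareTheta : ContinuousOn squareTheta {z : ℂ | 0 < z.im} := fun _ hz =>
  (differentiableAt_squareTheta hz).continuousAt.continuousWithinAt

lemma continuousOn_thetaTail (N : ℕ) : ContinuousOn (thetaTail N) {z : ℂ | 0 < z.im} := by
  unfold thetaTail
  refine (continuousOn_squareTheta.sub continuousOn_const).sub (Continuous.continuousOn ?_)
  exact continuous_const.mul (continuous_finsetSum _ fun n _ => continuous_squareExp n)

lemma lintegral_enorm_sq_thetaTail_le (N : ℕ) (a : ℝ) {y B : ℝ} (hy : 0 < y)
    (hB : ∀ M, ∑ n ∈ Finset.range M,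
      4 * Real.exp (-(4 * Real.pi * ((n + N + 1 : ℕ) : ℝ) ^ 2 * y)) ≤ B) :
    ∫⁻ x in Set.Ioc a (a + 1), ‖thetaTail N (x + y * Complex.I)‖ₑ ^ 2 ≤ ENNReal.ofReal B := by
  set S : ℕ → ℝ → ℂ := fun M x =>
    ∑ n ∈ Finset.range M, 2 * squareExp (n + N + 1) (x + y * Complex.I) with hS
  have hScont : ∀ M, Continuous (S M) := fun M => by
    refine continuous_finsetSum _ fun n _ => continuous_const.mul ?_
    exact (continuous_squareExp _).comp (by fun_prop)
  have hlim : ∀ x : ℝ, Tendsto (fun M => ‖S M x‖ₑ ^ 2) atTop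
      (𝓝 (‖thetaTail N (x + y * Complex.I)‖ₑ ^ 2)) := fun x => by
    have h := (hasSum_thetaTail N (z := x + y * Complex.I) (by simpa using hy)).tendsto_sum_nat
    exact (ENNReal.continuous_pow 2).continuousAt.tendsto.comp h.enorm
  calc ∫⁻ x in Set.Ioc a (a + 1), ‖thetaTail N (x + y * Complex.I)‖ₑ ^ 2
      = ∫⁻ x in Set.Ioc a (a + 1), liminf (fun M => ‖S M x‖ₑ ^ 2) atTop := by
        refine lintegral_congr fun x => ?_
        rw [(hlim x).liminf_eq]
    _ ≤ liminf (fun M => ∫⁻ x in Set.Ioc a (a + 1), ‖S M x‖ₑ ^ 2) atTop :=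
        lintegral_liminf_le fun M => ((hScont M).enorm.measurable.pow_const 2)
    _ ≤ ENNReal.ofReal B := by
        refine liminf_le_of_frequently_le' (Frequently.of_forall fun M => ?_)
        have e1 : ∀ x : ℝ, ‖S M x‖ₑ ^ 2 = ENNReal.ofReal (‖S M x‖ ^ 2) := fun x => by
          rw [ENNReal.ofReal_pow (norm_nonneg _), ofReal_norm]
        simp_rw [e1]
        rw [← ofReal_integral_eq_lintegral_ofReal]
        · refine ENNReal.ofReal_le_ofReal (le_trans (le_of_eq ?_) (hB M))
          rw [← intervalIntegral.integral_of_le (by linarith)]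
          have e2 : ∀ x : ℝ, S M x = ∑ n ∈ (Finset.range M).map (addRightEmbedding (N + 1)),
              (2 * (Real.exp (-(2 * Real.pi * (n : ℝ) ^ 2 * y)) : ℂ)) * squareExp n x := fun x => by
            rw [Finset.sum_map]
            refine Finset.sum_congr rfl fun n _ => ?_
            rw [squareExp_add_mul_I]
            simp only [addRightEmbedding_apply, ← add_assoc]
            ring
          simp_rw [e2]
          rw [integral_norm_sq_sum_squareExp, Finset.sum_map]
          refine Finset.sum_congr rfl fun n _ => ?_
          simp only [addRightEmbedding_apply, ← add_assoc]
          rw [norm_mul, Complex.norm_real, Real.norm_of_nonneg (Real.exp_pos _).le, mul_pow,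
            ← Real.exp_nat_mul]
          norm_num
          ring_nf
        · exact ((hScont M).norm.pow 2).integrableOn_Ioc
        · exact Eventually.of_forall fun x => by positivity

lemma exp_neg_le_rpow {u : ℝ} (hu : 0 < u) : Real.exp (-u) ≤ u ^ (-(3 / 4) : ℝ) := by
  rw [Real.rpow_neg hu.le, Real.exp_neg]
  apply inv_anti₀ (by positivity)
  have h1 : u ^ (3 / 4 : ℝ) ≤ 1 + u := by
    rcases le_total u 1 with h | h
    · have := Real.rpow_le_one hu.le h (show (0 : ℝ) ≤ 3 / 4 by norm_num)
      linarith
    · have := Real.rpow_le_rpow_of_exponent_le h (show (3 / 4 : ℝ) ≤ 1 by norm_num)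
      rw [Real.rpow_one] at this
      linarith
  linarith [Real.add_one_le_exp u]

/-- The constant `∑ n^{-5/4}`. -/
noncomputable def zetaFiveFourths : ℝ := ∑' n : ℕ, 1 / (n : ℝ) ^ (5 / 4 : ℝ)

lemma sum_exp_thetaTail_le {N : ℕ} (hN : 0 < N) {y : ℝ} (hy : 0 < y) (M : ℕ) :
    ∑ n ∈ Finset.range M, 4 * Real.exp (-(4 * Real.pi * ((n + N + 1 : ℕ) : ℝ) ^ 2 * y)) ≤
      4 * zetaFiveFourths * (N : ℝ) ^ (-(1 / 4) : ℝ) * (y ^ (-(3 / 4) : ℝ) *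
        Real.exp (-(2 * Real.pi * y))) := by
  have hsum : Summable fun n : ℕ => 1 / (n : ℝ) ^ (5 / 4 : ℝ) :=
    Real.summable_one_div_nat_rpow.2 (by norm_num)
  have hterm : ∀ n ∈ Finset.range M,
      4 * Real.exp (-(4 * Real.pi * ((n + N + 1 : ℕ) : ℝ) ^ 2 * y)) ≤
      (4 * (N : ℝ) ^ (-(1 / 4) : ℝ) * (y ^ (-(3 / 4) : ℝ) * Real.exp (-(2 * Real.pi * y)))) *
        (1 / ((n + (N + 1) : ℕ) : ℝ) ^ (5 / 4 : ℝ)) := by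
    intro n _
    rw [show n + (N + 1) = n + N + 1 by ring]
    set m : ℝ := ((n + N + 1 : ℕ) : ℝ) with hm
    have hNm : (N : ℝ) ≤ m := by
      rw [hm]; exact_mod_cast (by omega : N ≤ n + N + 1)
    have hN1 : (1 : ℝ) ≤ N := by exact_mod_cast hN
    have hm1 : 1 ≤ m := hN1.trans hNm
    have hm0 : 0 < m := by linarith
    have e1 : Real.exp (-(4 * Real.pi * m ^ 2 * y)) =
        Real.exp (-(2 * Real.pi * m ^ 2 * y)) * Real.exp (-(2 * Real.pi * m ^ 2 * y)) := by
      rw [← Real.exp_add]; ring_nf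
    have e2 : Real.exp (-(2 * Real.pi * m ^ 2 * y)) ≤ Real.exp (-(2 * Real.pi * y)) := by
      apply Real.exp_le_exp.2
      have : 1 ≤ m ^ 2 := by nlinarith
      have : 2 * Real.pi * y * 1 ≤ 2 * Real.pi * y * m ^ 2 := by gcongr
      nlinarith
    have e3 : Real.exp (-(2 * Real.pi * m ^ 2 * y)) ≤
        (N : ℝ) ^ (-(1 / 4) : ℝ) * (1 / m ^ (5 / 4 : ℝ)) * y ^ (-(3 / 4) : ℝ) := by
      calc _ ≤ (2 * Real.pi * m ^ 2 * y) ^ (-(3 / 4) : ℝ) := exp_neg_le_rpow (by positivity)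
        _ ≤ (m ^ 2 * y) ^ (-(3 / 4) : ℝ) := by
            apply Real.rpow_le_rpow_of_nonpos (by positivity) _ (by norm_num)
            have : 1 ≤ 2 * Real.pi := by linarith [Real.pi_gt_three]
            have h0 : 0 ≤ m ^ 2 * y := by positivity
            nlinarith
        _ = m ^ (-(1 / 4) : ℝ) * (1 / m ^ (5 / 4 : ℝ)) * y ^ (-(3 / 4) : ℝ) := by
            rw [Real.mul_rpow (by positivity) hy.le, ← Real.rpow_natCast m 2, ← Real.rpow_mul hm0.le,
              one_div (m ^ (5 / 4 : ℝ)), ← Real.rpow_neg hm0.le, ← Real.rpow_add hm0]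
            norm_num
        _ ≤ _ := by
            gcongr ?_ * _ * _
            exact Real.rpow_le_rpow_of_nonpos (by linarith) hNm (by norm_num)
    rw [e1]
    calc _ ≤ 4 * (Real.exp (-(2 * Real.pi * y)) *
          ((N : ℝ) ^ (-(1 / 4) : ℝ) * (1 / m ^ (5 / 4 : ℝ)) * y ^ (-(3 / 4) : ℝ))) := by gcongr
      _ = _ := by ring
  refine (Finset.sum_le_sum hterm).trans ?_
  rw [← Finset.mul_sum]
  have h2 : ∑ n ∈ Finset.range M, 1 / ((n + (N + 1) : ℕ) : ℝ) ^ (5 / 4 : ℝ) ≤ zetaFiveFourths := by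
    have := hsum.sum_le_tsum ((Finset.range M).map (addRightEmbedding (N + 1)))
      (fun _ _ => by positivity)
    rw [Finset.sum_map] at this
    exact this
  calc _ ≤ (4 * (N : ℝ) ^ (-(1 / 4) : ℝ) * (y ^ (-(3 / 4) : ℝ) * Real.exp (-(2 * Real.pi * y)))) *
        zetaFiveFourths := by gcongr
    _ = _ := by ring

lemma lintegral_enorm_le_of_lintegral_sq {α : Type*} [MeasurableSpace α] {μ : Measure α}
    (hμ : μ Set.univ = 1) {f : α → ℂ} {t : ℝ} (ht : 0 < t)
    (h : ∫⁻ x, ‖f x‖ₑ ^ 2 ∂μ ≤ ENNReal.ofReal (t ^ 2)) :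
    ∫⁻ x, ‖f x‖ₑ ∂μ ≤ ENNReal.ofReal t := by
  have hpt : ∀ x, ‖f x‖ₑ ≤ ENNReal.ofReal (1 / (2 * t)) * ‖f x‖ₑ ^ 2 + ENNReal.ofReal (t / 2) := by
    intro x
    rw [← ofReal_norm, ← ENNReal.ofReal_pow (norm_nonneg _),
      ← ENNReal.ofReal_mul (by positivity), ← ENNReal.ofReal_add (by positivity) (by positivity)]
    apply ENNReal.ofReal_le_ofReal
    have : 1 / (2 * t) * ‖f x‖ ^ 2 + t / 2 - ‖f x‖ = (‖f x‖ - t) ^ 2 / (2 * t) := by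
      field_simp; ring
    have h0 : 0 ≤ (‖f x‖ - t) ^ 2 / (2 * t) := by positivity
    linarith
  calc _ ≤ ∫⁻ x, (ENNReal.ofReal (1 / (2 * t)) * ‖f x‖ₑ ^ 2 + ENNReal.ofReal (t / 2)) ∂μ :=
        lintegral_mono hpt
    _ = ENNReal.ofReal (1 / (2 * t)) * ∫⁻ x, ‖f x‖ₑ ^ 2 ∂μ + ENNReal.ofReal (t / 2) := by
        rw [lintegral_add_right _ measurable_const, lintegral_const_mul' _ _ ENNReal.ofReal_ne_top,
          lintegral_const, hμ, mul_one]
    _ ≤ ENNReal.ofReal (1 / (2 * t)) * ENNReal.ofReal (t ^ 2) + ENNReal.ofReal (t / 2) := by gcongr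
    _ = ENNReal.ofReal t := by
        rw [← ENNReal.ofReal_mul (by positivity), ← ENNReal.ofReal_add (by positivity) (by positivity)]
        congr 1
        field_simp
        ring

/-- The function `(1/√2) ∫_0^∞ (θ(x + iy) - 1) y^{-1/2} dy`, which represents the square series. -/
noncomputable def thetaIntegral (x : ℝ) : ℂ :=
  ((1 / Real.sqrt 2 : ℝ) : ℂ) *
    ∫ y in Set.Ioi (0 : ℝ), (squareTheta (x + y * Complex.I) - 1) * ((y ^ (-(1 / 2) : ℝ) : ℝ) : ℂ)

/-- The mass `∫_0^∞ |thetaTail N (x + iy)| y^{-1/2} dy`. -/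
noncomputable def tailMass (N : ℕ) (x : ℝ) : ENNReal :=
  ∫⁻ y in Set.Ioi (0 : ℝ), ‖thetaTail N (x + y * Complex.I)‖ₑ * ENNReal.ofReal (y ^ (-(1 / 2) : ℝ))

lemma aemeasurable_thetaTail_prod (N : ℕ) (a : ℝ) :
    AEMeasurable (Function.uncurry fun x y : ℝ =>
      ‖thetaTail N (x + y * Complex.I)‖ₑ * ENNReal.ofReal (y ^ (-(1 / 2) : ℝ)))
      ((volume.restrict (Set.Ioc a (a + 1))).prod (volume.restrict (Set.Ioi (0 : ℝ)))) := by
  rw [Measure.prod_restrict]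
  refine AEMeasurable.mul (f := fun p : ℝ × ℝ => ‖thetaTail N (p.1 + p.2 * Complex.I)‖ₑ)
    (g := fun p : ℝ × ℝ => ENNReal.ofReal (p.2 ^ (-(1 / 2) : ℝ))) ?_ ?_
  · refine AEStronglyMeasurable.enorm (ContinuousOn.aestronglyMeasurable
      (f := fun p : ℝ × ℝ => thetaTail N (p.1 + p.2 * Complex.I)) ?_
      (measurableSet_Ioc.prod measurableSet_Ioi))
    refine (continuousOn_thetaTail N).comp (by fun_prop) ?_
    rintro ⟨x, y⟩ ⟨_, hy⟩
    simpa using hy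
  · fun_prop

lemma integrableOn_rpow_mul_exp_neg_pi :
    IntegrableOn (fun y : ℝ => y ^ (-(7 / 8) : ℝ) * Real.exp (-(Real.pi * y))) (Set.Ioi 0) := by
  have h := integrableOn_rpow_mul_exp_neg_mul_rpow (p := 1) (s := -(7 / 8)) (b := Real.pi)
    (by norm_num) (by norm_num) Real.pi_pos
  refine h.congr_fun (fun y _ => ?_) measurableSet_Ioi
  simp

lemma exists_lintegral_tailMass_le : ∃ C : ℝ, 0 ≤ C ∧ ∀ (N : ℕ), 0 < N → ∀ a : ℝ,
    ∫⁻ x in Set.Ioc a (a + 1), tailMass N x ≤ ENNReal.ofReal (C * (N : ℝ) ^ (-(1 / 8) : ℝ)) := by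
  have hZ : 0 < zetaFiveFourths :=
    (Real.summable_one_div_nat_rpow.2 (by norm_num)).tsum_pos (fun _ => by positivity) 1 (by simp)
  set J := ∫ y in Set.Ioi (0 : ℝ), y ^ (-(7 / 8) : ℝ) * Real.exp (-(Real.pi * y)) with hJ
  have hJ0 : 0 ≤ J := setIntegral_nonneg measurableSet_Ioi fun y (hy : 0 < y) => by positivity
  refine ⟨2 * Real.sqrt zetaFiveFourths * J, by positivity, fun N hN a => ?_⟩
  have hN0 : (0 : ℝ) < N := by exact_mod_cast hN
  unfold tailMass
  rw [lintegral_lintegral_swap (aemeasurable_thetaTail_prod N a)]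
  have hpt : ∀ y ∈ Set.Ioi (0 : ℝ), ∫⁻ x in Set.Ioc a (a + 1),
      ‖thetaTail N (x + y * Complex.I)‖ₑ * ENNReal.ofReal (y ^ (-(1 / 2) : ℝ)) ≤
      ENNReal.ofReal ((2 * Real.sqrt zetaFiveFourths * (N : ℝ) ^ (-(1 / 8) : ℝ)) *
        (y ^ (-(7 / 8) : ℝ) * Real.exp (-(Real.pi * y)))) := by
    intro y (hy : 0 < y)
    set t : ℝ := 2 * Real.sqrt zetaFiveFourths * (N : ℝ) ^ (-(1 / 8) : ℝ) *
      (y ^ (-(3 / 8) : ℝ) * Real.exp (-(Real.pi * y))) with ht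
    have ht0 : 0 < t := by positivity
    have hsq : t ^ 2 = 4 * zetaFiveFourths * (N : ℝ) ^ (-(1 / 4) : ℝ) * (y ^ (-(3 / 4) : ℝ) *
        Real.exp (-(2 * Real.pi * y))) := by
      rw [ht]
      simp only [mul_pow]
      rw [Real.sq_sqrt hZ.le, ← Real.rpow_natCast, ← Real.rpow_natCast (y ^ _), ← Real.exp_nat_mul,
        ← Real.rpow_natCast (_ ^ _), ← Real.rpow_mul hy.le, ← Real.rpow_mul hN0.le]
      norm_num
      ring_nf
      simp
    have h1 : ∫⁻ x in Set.Ioc a (a + 1), ‖thetaTail N (x + y * Complex.I)‖ₑ ≤ ENNReal.ofReal t := by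
      refine lintegral_enorm_le_of_lintegral_sq (by simp) ht0 ?_
      rw [hsq]
      exact lintegral_enorm_sq_thetaTail_le N a hy (sum_exp_thetaTail_le hN hy)
    rw [lintegral_mul_const' _ _ ENNReal.ofReal_ne_top]
    calc _ ≤ ENNReal.ofReal t * ENNReal.ofReal (y ^ (-(1 / 2) : ℝ)) := by gcongr
      _ = _ := by
        rw [← ENNReal.ofReal_mul ht0.le, ht]
        congr 1
        rw [show (-(7 / 8) : ℝ) = -(3 / 8) + -(1 / 2) by norm_num, Real.rpow_add hy]
        ring
  refine (setLIntegral_mono' measurableSet_Ioi hpt).trans ?_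
  rw [← ofReal_integral_eq_lintegral_ofReal (integrableOn_rpow_mul_exp_neg_pi.const_mul _)]
  · rw [integral_const_mul]
    apply le_of_eq
    congr 1
    ring
  · filter_upwards [ae_restrict_mem measurableSet_Ioi] with y hy
    have : 0 < y := hy
    positivity

lemma integrableOn_squareExp_vertical {n : ℕ} (hn : 0 < n) (x : ℝ) :
    IntegrableOn (fun y : ℝ => squareExp n (x + y * Complex.I) * ((y ^ (-(1 / 2) : ℝ) : ℝ) : ℂ))
      (Set.Ioi 0) ∧
    ∫ y in Set.Ioi (0 : ℝ), squareExp n (x + y * Complex.I) * ((y ^ (-(1 / 2) : ℝ) : ℝ) : ℂ) =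
      squareExp n x * ((1 / (Real.sqrt 2 * n) : ℝ) : ℂ) := by
  have hn0 : (0 : ℝ) < n := by exact_mod_cast hn
  have hr : 0 < 2 * Real.pi * (n : ℝ) ^ 2 := by positivity
  have e : ∀ y : ℝ, squareExp n (x + y * Complex.I) * ((y ^ (-(1 / 2) : ℝ) : ℝ) : ℂ) =
      squareExp n x * ((y ^ ((1 / 2 : ℝ) - 1) * Real.exp (-(2 * Real.pi * (n : ℝ) ^ 2 * y)) : ℝ) : ℂ) := by
    intro y
    rw [squareExp_add_mul_I]
    push_cast
    norm_num
    ring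
  simp_rw [e]
  constructor
  · have h := integrableOn_rpow_mul_exp_neg_mul_rpow (p := 1) (s := (1 / 2 : ℝ) - 1)
      (b := 2 * Real.pi * (n : ℝ) ^ 2) (by norm_num) (by norm_num) hr
    have h' : IntegrableOn (fun y : ℝ => y ^ ((1 / 2 : ℝ) - 1) *
        Real.exp (-(2 * Real.pi * (n : ℝ) ^ 2 * y))) (Set.Ioi 0) :=
      h.congr_fun (fun y _ => by simp) measurableSet_Ioi
    exact Integrable.const_mul (Integrable.ofReal h') _
  · rw [integral_const_mul, integral_complex_ofReal, Real.integral_rpow_mul_exp_neg_mul_Ioi (by norm_num) hr,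
      Real.Gamma_one_half_eq, ← Real.sqrt_eq_rpow]
    congr 2
    rw [Real.sqrt_div (by norm_num), Real.sqrt_one, Real.sqrt_mul (by positivity),
      Real.sqrt_mul (by norm_num), Real.sqrt_sq hn0.le]
    have : Real.sqrt Real.pi ≠ 0 := by positivity
    field_simp

lemma thetaTail_eq_sub_one_sub (N : ℕ) (z : ℂ) :
    squareTheta z - 1 = thetaTail N z + 2 * ∑ n ∈ Finset.Icc 1 N, squareExp n z := by
  rw [thetaTail]; ring

lemma integrableOn_thetaTail_of_tailMass {N : ℕ} {x : ℝ} (h : tailMass N x < ⊤) :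
    IntegrableOn (fun y : ℝ => thetaTail N (x + y * Complex.I) * ((y ^ (-(1 / 2) : ℝ) : ℝ) : ℂ))
      (Set.Ioi 0) := by
  refine ⟨?_, ?_⟩
  · refine ContinuousOn.aestronglyMeasurable ?_ measurableSet_Ioi
    refine ContinuousOn.mul ?_ ?_
    · refine (continuousOn_thetaTail N).comp (by fun_prop) fun y hy => ?_
      simpa using hy
    · refine Complex.continuous_ofReal.comp_continuousOn fun y hy => ?_
      exact (Real.continuousAt_rpow_const _ _ (Or.inl (ne_of_gt hy))).continuousWithinAt
  · refine lt_of_le_of_lt (le_of_eq ?_) h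
    refine setLIntegral_congr_fun measurableSet_Ioi fun y (hy : 0 < y) => ?_
    rw [enorm_mul]
    congr 1
    rw [← ofReal_norm, Complex.norm_real, Real.norm_of_nonneg (by positivity)]

lemma integrableOn_sum_squareExp (N : ℕ) (x : ℝ) :
    IntegrableOn (fun y : ℝ => (2 * ∑ n ∈ Finset.Icc 1 N, squareExp n (x + y * Complex.I)) *
      ((y ^ (-(1 / 2) : ℝ) : ℝ) : ℂ)) (Set.Ioi 0) ∧
    ((1 / Real.sqrt 2 : ℝ) : ℂ) * ∫ y in Set.Ioi (0 : ℝ),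
      (2 * ∑ n ∈ Finset.Icc 1 N, squareExp n (x + y * Complex.I)) *
        ((y ^ (-(1 / 2) : ℝ) : ℝ) : ℂ) = squareSeriesPartial N x := by
  have e : ∀ y : ℝ, (2 * ∑ n ∈ Finset.Icc 1 N, squareExp n (x + y * Complex.I)) *
      ((y ^ (-(1 / 2) : ℝ) : ℝ) : ℂ) = 2 * ∑ n ∈ Finset.Icc 1 N,
        squareExp n (x + y * Complex.I) * ((y ^ (-(1 / 2) : ℝ) : ℝ) : ℂ) := by
    intro y
    rw [mul_assoc, Finset.sum_mul]
  have hn : ∀ n ∈ Finset.Icc 1 N, 0 < n := fun n h => (Finset.mem_Icc.1 h).1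
  simp_rw [e]
  constructor
  · exact Integrable.const_mul
      (integrable_finsetSum _ fun n h => (integrableOn_squareExp_vertical (hn n h) x).1) _
  · rw [integral_const_mul,
      integral_finsetSum _ fun n h => (integrableOn_squareExp_vertical (hn n h) x).1,
      squareSeriesPartial, Finset.mul_sum, Finset.mul_sum]
    refine Finset.sum_congr rfl fun n h => ?_
    rw [(integrableOn_squareExp_vertical (hn n h) x).2, squareExp]
    have h2 : ((1 / Real.sqrt 2 : ℝ) : ℂ) * (2 * ((1 / (Real.sqrt 2 * n) : ℝ) : ℂ)) = 1 / (n : ℂ) := by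
      have hn0 : (0 : ℝ) < n := by exact_mod_cast hn n h
      have : (1 / Real.sqrt 2) * (2 * (1 / (Real.sqrt 2 * n))) = 1 / (n : ℝ) := by
        have := Real.mul_self_sqrt (show (0 : ℝ) ≤ 2 by norm_num)
        field_simp
        nlinarith
      have h3 := congrArg (fun r : ℝ => (r : ℂ)) this
      push_cast at h3 ⊢
      exact h3
    rw [div_eq_mul_one_div (Complex.exp _) (n : ℂ), ← h2]
    ring

lemma integrableOn_theta_of_tailMass {N : ℕ} {x : ℝ} (h : tailMass N x < ⊤) :
    IntegrableOn (fun y : ℝ => (squareTheta (x + y * Complex.I) - 1) *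
      ((y ^ (-(1 / 2) : ℝ) : ℝ) : ℂ)) (Set.Ioi 0) := by
  simp_rw [thetaTail_eq_sub_one_sub N, add_mul]
  exact (integrableOn_thetaTail_of_tailMass h).add (integrableOn_sum_squareExp N x).1

lemma enorm_thetaIntegral_sub_partial_le (N : ℕ) (x : ℝ) :
    ‖thetaIntegral x - squareSeriesPartial N x‖ₑ ≤ tailMass N x := by
  rcases eq_or_ne (tailMass N x) ⊤ with h | h
  · rw [h]; exact le_top
  have h' : tailMass N x < ⊤ := lt_of_le_of_ne le_top h
  have e : thetaIntegral x - squareSeriesPartial N x = ((1 / Real.sqrt 2 : ℝ) : ℂ) *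
      ∫ y in Set.Ioi (0 : ℝ), thetaTail N (x + y * Complex.I) * ((y ^ (-(1 / 2) : ℝ) : ℝ) : ℂ) := by
    rw [thetaIntegral, ← (integrableOn_sum_squareExp N x).2, ← mul_sub]
    congr 1
    simp_rw [thetaTail_eq_sub_one_sub N, add_mul]
    rw [integral_add (integrableOn_thetaTail_of_tailMass h') (integrableOn_sum_squareExp N x).1]
    ring
  rw [e, enorm_mul]
  have h1 : ‖((1 / Real.sqrt 2 : ℝ) : ℂ)‖ₑ ≤ 1 := by
    rw [← ofReal_norm, Complex.norm_real, Real.norm_of_nonneg (by positivity)]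
    rw [ENNReal.ofReal_le_one, div_le_one (by positivity)]
    exact Real.one_le_sqrt.2 (by norm_num)
  calc _ ≤ 1 * ∫⁻ y in Set.Ioi (0 : ℝ),
        ‖thetaTail N (x + y * Complex.I) * ((y ^ (-(1 / 2) : ℝ) : ℝ) : ℂ)‖ₑ := by
        gcongr
        exact enorm_integral_le_lintegral_enorm _
    _ = tailMass N x := by
        rw [one_mul, tailMass]
        refine setLIntegral_congr_fun measurableSet_Ioi fun y (hy : 0 < y) => ?_
        rw [enorm_mul]
        congr 1
        rw [← ofReal_norm, Complex.norm_real, Real.norm_of_nonneg (by positivity)]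

lemma continuous_squareSeriesPartial (N : ℕ) : Continuous (squareSeriesPartial N) := by
  unfold squareSeriesPartial
  fun_prop

lemma norm_squareSeriesPartial_sub_le {M N : ℕ} (hMN : M ≤ N) (hM : 0 < M) (x : ℝ) :
    ‖squareSeriesPartial N x - squareSeriesPartial M x‖ ≤ ((N : ℝ) - M) / M := by
  have hM0 : (0 : ℝ) < M := by exact_mod_cast hM
  have e : squareSeriesPartial N x - squareSeriesPartial M x =
      ∑ n ∈ Finset.Ioc M N, squareExp n x / (n : ℂ) := by
    rw [squareSeriesPartial, squareSeriesPartial, sub_eq_iff_eq_add']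
    have : Finset.Icc 1 N = Finset.Icc 1 M ∪ Finset.Ioc M N := by
      ext n; simp only [Finset.mem_Icc, Finset.mem_union, Finset.mem_Ioc]; omega
    rw [this, Finset.sum_union]
    · rfl
    · rw [Finset.disjoint_left]
      intro n; simp only [Finset.mem_Icc, Finset.mem_Ioc]; omega
  rw [e]
  calc _ ≤ ∑ n ∈ Finset.Ioc M N, 1 / (M : ℝ) := by
        refine (norm_sum_le _ _).trans (Finset.sum_le_sum fun n hn => ?_)
        rw [norm_div, norm_squareExp_ofReal, Complex.norm_natCast]
        have : (M : ℝ) ≤ n := by exact_mod_cast (Finset.mem_Ioc.1 hn).1.le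
        gcongr
    _ = _ := by
        rw [Finset.sum_const, Nat.card_Ioc, nsmul_eq_mul, Nat.cast_sub hMN]
        ring

lemma ae_of_forall_Ioc_add_one {P : ℝ → Prop}
    (h : ∀ a : ℤ, ∀ᵐ x ∂(volume.restrict (Set.Ioc (a : ℝ) (a + 1))), P x) : ∀ᵐ x : ℝ, P x := by
  have h2 : ∀ᵐ x : ℝ, ∀ a : ℤ, x ∈ Set.Ioc (a : ℝ) (a + 1) → P x := by
    rw [ae_all_iff]
    intro a
    exact (ae_restrict_iff' measurableSet_Ioc).1 (h a)
  filter_upwards [h2] with x hx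
  refine hx (⌈x⌉ - 1) ⟨?_, ?_⟩
  · push_cast; linarith [Int.ceil_lt_add_one x]
  · push_cast; linarith [Int.le_ceil x]

/-- If the partial sums converge along the `d`-th powers, they converge. -/
lemma tendsto_squareSeriesPartial_of_pow {d : ℕ} (hd : d ≠ 0) {x : ℝ} {l : ℂ}
    (h : Tendsto (fun k : ℕ => squareSeriesPartial ((k + 1) ^ d) x) atTop (𝓝 l)) :
    Tendsto (fun N : ℕ => squareSeriesPartial N x) atTop (𝓝 l) := by
  have hk : ∀ N : ℕ, 0 < N → ∃ k, (k + 1) ^ d ≤ N ∧ N < (k + 2) ^ d := by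
    intro N hN
    have hex : ∃ m, N < (m + 1) ^ d := ⟨N, lt_of_lt_of_le (Nat.lt_succ_self N)
      (Nat.le_self_pow hd _)⟩
    have h1 := Nat.find_spec hex
    have h0 : Nat.find hex ≠ 0 := by
      intro h0
      rw [h0] at h1
      simp at h1
      omega
    obtain ⟨k, hk⟩ := Nat.exists_eq_succ_of_ne_zero h0
    refine ⟨k, ?_, ?_⟩
    · have := Nat.find_min hex (m := k) (by omega)
      omega
    · rw [hk] at h1
      exact h1
  have hk' : ∀ N : ℕ, ∃ k, 0 < N → (k + 1) ^ d ≤ N ∧ N < (k + 2) ^ d := fun N => by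
    by_cases hN : 0 < N
    · obtain ⟨k, hk⟩ := hk N hN
      exact ⟨k, fun _ => hk⟩
    · exact ⟨0, fun h => absurd h hN⟩
  choose κ hκ using hk'
  have hκtop : Tendsto κ atTop atTop := by
    rw [tendsto_atTop]
    intro b
    filter_upwards [eventually_ge_atTop ((b + 2) ^ d), eventually_gt_atTop 0] with N hN hN0
    have := (hκ N hN0).2
    by_contra! hlt
    have : (κ N + 2) ^ d ≤ (b + 2) ^ d := Nat.pow_le_pow_left (by omega) _
    omega
  have h1 := h.comp hκtop
  have hdiff : Tendsto (fun N : ℕ => squareSeriesPartial N x -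
      squareSeriesPartial ((κ N + 1) ^ d) x) atTop (𝓝 0) := by
    have hb : Tendsto (fun k : ℕ => ((1 + 1 / ((k : ℝ) + 1)) ^ d - 1)) atTop (𝓝 0) := by
      have := ((tendsto_one_div_add_atTop_nhds_zero_nat (𝕜 := ℝ)).const_add 1).pow d |>.sub_const 1
      simpa using this
    refine squeeze_zero_norm' ?_ (hb.comp hκtop)
    filter_upwards [eventually_gt_atTop 0] with N hN
    obtain ⟨h2, h3⟩ := hκ N hN
    refine (norm_squareSeriesPartial_sub_le h2 (by positivity) x).trans ?_
    have h3' : (N : ℝ) ≤ ((κ N : ℝ) + 2) ^ d := by exact_mod_cast h3.le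
    simp only [Function.comp]
    have hp : (0 : ℝ) < (κ N : ℝ) + 1 := by positivity
    have e : (1 + 1 / ((κ N : ℝ) + 1)) ^ d - 1 =
        (((κ N : ℝ) + 2) ^ d - ((κ N : ℝ) + 1) ^ d) / ((κ N : ℝ) + 1) ^ d := by
      rw [sub_div, div_self (by positivity), ← div_pow]
      congr 2
      field_simp
      ring
    rw [e]
    push_cast
    gcongr
  have := h1.add hdiff
  simpa using this

/-- Almost everywhere the square series converges to `thetaIntegral`. -/
lemma ae_tendsto_squareSeriesPartial : ∀ᵐ x : ℝ,
    Tendsto (fun N : ℕ => squareSeriesPartial N x) atTop (𝓝 (thetaIntegral x)) ∧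
    IntegrableOn (fun y : ℝ => (squareTheta (x + y * Complex.I) - 1) *
      ((y ^ (-(1 / 2) : ℝ) : ℝ) : ℂ)) (Set.Ioi 0) := by
  obtain ⟨C, hC0, hC⟩ := exists_lintegral_tailMass_le
  refine ae_of_forall_Ioc_add_one fun a => ?_
  have hmeas : ∀ N, AEMeasurable (tailMass N) (volume.restrict (Set.Ioc (a : ℝ) (a + 1))) :=
    fun N => (aemeasurable_thetaTail_prod N a).lintegral_prod_right'
  have hfin : ∫⁻ x in Set.Ioc (a : ℝ) (a + 1), ∑' k : ℕ, tailMass ((k + 1) ^ 16) x ≠ ⊤ := by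
    rw [lintegral_tsum fun k => hmeas _]
    refine ne_top_of_le_ne_top ?_ (ENNReal.tsum_le_tsum fun k => hC ((k + 1) ^ 16) (by positivity) a)
    have hs : Summable fun k : ℕ => C * (((k + 1) ^ 16 : ℕ) : ℝ) ^ (-(1 / 8) : ℝ) := by
      have h2 : Summable fun k : ℕ => 1 / ((k : ℝ) + 1) ^ 2 := by
        have := (summable_nat_add_iff 1).2 (Real.summable_one_div_nat_pow.2 (show 1 < 2 by norm_num))
        simpa using this
      refine (h2.mul_left C).congr fun k => ?_
      push_cast
      have hp : (0 : ℝ) < (k : ℝ) + 1 := by positivity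
      rw [← Real.rpow_natCast (_ + 1) 16, ← Real.rpow_mul hp.le, one_div, ← Real.rpow_natCast,
        ← Real.rpow_neg hp.le]
      norm_num
    exact hs.tsum_ofReal_ne_top
  have hae := ae_lt_top' (AEMeasurable.tsum fun k => hmeas _) hfin
  filter_upwards [hae] with x hx
  have hx0 := ENNReal.tendsto_atTop_zero_of_tsum_ne_top hx.ne
  refine ⟨tendsto_squareSeriesPartial_of_pow (d := 16) (by norm_num) ?_, ?_⟩
  · rw [tendsto_iff_edist_tendsto_0]
    refine tendsto_of_tendsto_of_tendsto_of_le_of_le tendsto_const_nhds hx0 (fun _ => zero_le) ?_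
    intro k
    change edist (squareSeriesPartial ((k + 1) ^ 16) x) (thetaIntegral x) ≤ _
    rw [edist_comm, edist_eq_enorm_sub]
    exact enorm_thetaIntegral_sub_partial_le _ x
  · refine integrableOn_theta_of_tailMass (N := 1) ?_
    have := ENNReal.le_tsum (f := fun k : ℕ => tailMass ((k + 1) ^ 16) x) 0
    simp only [zero_add, one_pow] at this
    exact this.trans_lt hx

lemma ae_squareSeries_eq_thetaIntegral : ∀ᵐ x : ℝ, squareSeries x = thetaIntegral x := by
  filter_upwards [ae_tendsto_squareSeriesPartial] with x hx
  exact hx.1.limUnder_eq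

lemma aestronglyMeasurable_squareSeries : AEStronglyMeasurable squareSeries volume := by
  refine aestronglyMeasurable_of_tendsto_ae atTop
    (fun N => (continuous_squareSeriesPartial N).aestronglyMeasurable) ?_
  filter_upwards [ae_tendsto_squareSeriesPartial, ae_squareSeries_eq_thetaIntegral] with x hx hx'
  rw [hx']
  exact hx.1

lemma integrableOn_squareSeries_Ico : IntegrableOn squareSeries (Set.Ico (0 : ℝ) 1) := by
  rw [integrableOn_Ico_iff_integrableOn_Ioo, ← integrableOn_Ioc_iff_integrableOn_Ioo]
  obtain ⟨C, hC0, hC⟩ := exists_lintegral_tailMass_le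
  have h1 : IntegrableOn (fun x => squareSeries x - squareSeriesPartial 1 x) (Set.Ioc (0 : ℝ) 1) := by
    refine ⟨(aestronglyMeasurable_squareSeries.sub
      (continuous_squareSeriesPartial 1).aestronglyMeasurable).restrict, ?_⟩
    have h2 := hC 1 one_pos 0
    rw [zero_add] at h2
    refine lt_of_le_of_lt (le_trans (lintegral_mono_ae ?_) h2) ENNReal.ofReal_lt_top
    filter_upwards [ae_restrict_of_ae ae_squareSeries_eq_thetaIntegral] with x hx
    rw [hx]
    exact enorm_thetaIntegral_sub_partial_le 1 x
  have := h1.add ((continuous_squareSeriesPartial 1).integrableOn_Ioc (a := 0) (b := 1))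
  refine this.congr (Eventually.of_forall fun x => ?_)
  simp

/-! ### Convergents -/

/-- An irrational number in terms of two consecutive convergents and a complete quotient. -/
lemma Irrational.exists_convergent_eq_div (n : ℕ) : ∀ x : ℝ, Irrational x →
    ∃ p q p' q' : ℤ, ∃ t : ℝ, (x.convergent n : ℝ) = (p : ℝ) / q ∧ 1 ≤ q ∧ 0 ≤ q' ∧ q' ≤ q ∧
      (p * q' - p' * q = 1 ∨ p * q' - p' * q = -1) ∧ 0 < t ∧ t < 1 ∧
      x * (q + t * q') = p + t * p' ∧ (1 < x → 0 ≤ p' ∧ p' ≤ p ∧ 1 ≤ p) := by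
  induction n with
  | zero =>
    intro x hx
    have hfr : Int.fract x ≠ 0 := by
      intro h0
      have := Int.floor_add_fract x
      rw [h0, add_zero] at this
      exact hx.ne_int _ this.symm
    refine ⟨⌊x⌋, 1, 1, 0, Int.fract x, ?_, le_refl _, le_refl _, by norm_num, Or.inr (by ring),
      lt_of_le_of_ne (Int.fract_nonneg x) hfr.symm, Int.fract_lt_one x, ?_, fun h => ?_⟩
    · simp
    · push_cast
      have := Int.floor_add_fract x
      linarith
    · have : 1 ≤ ⌊x⌋ := Int.le_floor.2 (by exact_mod_cast h.le)
      exact ⟨by norm_num, this, this⟩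
  | succ n ih =>
    intro x hx
    have hfr : Int.fract x ≠ 0 := by
      intro h0
      have := Int.floor_add_fract x
      rw [h0, add_zero] at this
      exact hx.ne_int _ this.symm
    have hf0 : 0 < Int.fract x := lt_of_le_of_ne (Int.fract_nonneg x) hfr.symm
    have hirr : Irrational (Int.fract x)⁻¹ := by
      rw [irrational_inv_iff]
      have h : x - (⌊x⌋ : ℤ) = Int.fract x := rfl
      rw [← h]
      exact hx.sub_intCast _
    have h1 : 1 < (Int.fract x)⁻¹ := (one_lt_inv₀ hf0).2 (Int.fract_lt_one x)
    obtain ⟨p, q, p', q', t, hc, hq, hq'0, hq'q, hdet, ht0, ht1, hx', hp⟩ := ih _ hirr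
    obtain ⟨hp'0, hp'p, hp1⟩ := hp h1
    refine ⟨⌊x⌋ * p + q, p, ⌊x⌋ * p' + q', p', t, ?_, hp1, hp'0, hp'p, ?_, ht0, ht1, ?_, fun h => ?_⟩
    · rw [Real.convergent_succ]
      push_cast
      rw [hc, inv_div]
      have : (p : ℝ) ≠ 0 := by
        have : p ≠ 0 := by omega
        exact_mod_cast this
      field_simp
    · rcases hdet with h | h
      · right; linear_combination -h
      · left; linear_combination -h
    · have h2 : (q + t * q' : ℝ) = Int.fract x * (p + t * p') := by
        rw [← hx']; field_simp
      have := Int.floor_add_fract x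
      push_cast
      calc x * (p + t * p') = (⌊x⌋ + Int.fract x) * (p + t * p') := by rw [this]
        _ = ⌊x⌋ * (p + t * p') + (q + t * q') := by rw [h2]; ring
        _ = _ := by ring
    · have hfl : 1 ≤ ⌊x⌋ := Int.le_floor.2 (by exact_mod_cast h.le)
      refine ⟨by positivity, ?_, by nlinarith⟩
      have : ⌊x⌋ * p' ≤ ⌊x⌋ * p := mul_le_mul_of_nonneg_left hp'p (by omega)
      omega

/-- The approximation properties of the convergents that are used: the convergent `p/q` is close,
and no fraction with a smaller denominator is as close. -/
def IsGoodApprox (p q : ℕ) (x : ℝ) : Prop :=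
  |x - p / q| ≤ 1 / (q : ℝ) ^ 2 ∧ ∀ a b : ℤ, 0 < b → b < q → 1 / (2 * (q : ℝ)) ≤ |b * x - a|

lemma isGoodApprox_of_mem_convergentInterval {p q j : ℕ} (hq : 0 < q) (hpq : p.Coprime q) {x : ℝ}
    (hx : Irrational x) (hmem : x ∈ convergentInterval p q j) : IsGoodApprox p q x := by
  obtain ⟨P, Q, P', Q', t, hc, hQ, hQ'0, hQ'Q, hdet, ht0, ht1, hxt, -⟩ :=
    Irrational.exists_convergent_eq_div j x hx
  have hpq' : ((P : ℚ) / Q) = ((p : ℤ) : ℚ) / ((q : ℤ) : ℚ) := by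
    have h1 := hmem.2
    rw [Real.convs_eq_convergent, hc] at h1
    rw [← @Rat.cast_inj ℝ]
    push_cast
    exact h1
  have hcop : Nat.Coprime P.natAbs Q.natAbs := by
    rw [← Int.isCoprime_iff_nat_coprime]
    rcases hdet with h | h
    · exact ⟨Q', -P', by linear_combination h⟩
    · exact ⟨-Q', P', by linear_combination -h⟩
  obtain ⟨rfl, rfl⟩ := Rat.div_int_inj (by omega) (by exact_mod_cast hq) hcop (by simpa using hpq) hpq'
  have hq0 : (0 : ℝ) < q := by exact_mod_cast hq
  have hQ'0' : (0 : ℝ) ≤ Q' := by exact_mod_cast hQ'0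
  have hQ'Q' : (Q' : ℝ) ≤ q := by exact_mod_cast hQ'Q
  push_cast at hxt
  set D : ℝ := q + t * Q' with hD
  have hDq : (q : ℝ) ≤ D := by rw [hD]; nlinarith
  have hD2 : D ≤ 2 * q := by rw [hD]; nlinarith
  have hD0 : 0 < D := by linarith
  constructor
  · have e : (x - p / q) * (q * D) = t * (P' * q - p * Q') := by
      have h2 : (x - p / q) * (q * D) = q * (x * D) - p * D := by field_simp
      rw [h2, hxt, hD]; ring
    have habs : |x - p / q| * (q * D) = t := by
      rw [← abs_of_pos (by positivity : (0 : ℝ) < q * D), ← abs_mul, e, abs_mul, abs_of_pos ht0]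
      have : |(P' * q - p * Q' : ℝ)| = 1 := by
        rcases hdet with h | h
        · have : (p * Q' - P' * q : ℝ) = 1 := by exact_mod_cast h
          rw [show (P' * q - p * Q' : ℝ) = -1 by linarith]; simp
        · have : (p * Q' - P' * q : ℝ) = -1 := by exact_mod_cast h
          rw [show (P' * q - p * Q' : ℝ) = 1 by linarith]; simp
      rw [this, mul_one]
    rw [le_div_iff₀ (by positivity)]
    calc |x - p / q| * (q : ℝ) ^ 2 ≤ |x - p / q| * (q * D) := by
          gcongr; nlinarith
      _ ≤ 1 := by rw [habs]; exact ht1.le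
  · intro a b hb hbq
    have e : (b * x - a) * D = ((b * p - a * q : ℤ) : ℝ) + t * ((b * P' - a * Q' : ℤ) : ℝ) := by
      have : (b * x - a) * D = b * (x * D) - a * D := by ring
      rw [this, hxt, hD]; push_cast; ring
    set m : ℤ := b * p - a * q with hm
    set k : ℤ := b * P' - a * Q' with hk
    have hrel : m * Q' - k * q = b * (p * Q' - P' * q) := by rw [hm, hk]; ring
    have hqz : (0 : ℤ) < q := by exact_mod_cast hq
    have hrel' : m * Q' - k * q = b ∨ m * Q' - k * q = -b := by
      rcases hdet with h | h
      · left; rw [hrel, h, mul_one]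
      · right; rw [hrel, h]; ring
    have hmk : (1 ≤ m ∧ 0 ≤ k) ∨ (m ≤ -1 ∧ k ≤ 0) := by
      rcases lt_trichotomy m 0 with h0 | h0 | h0
      · right
        refine ⟨by omega, ?_⟩
        by_contra! hk0
        have h1 : (q : ℤ) ≤ k * q := by nlinarith
        have h2 : m * Q' ≤ 0 := mul_nonpos_of_nonpos_of_nonneg h0.le hQ'0
        rcases hrel' with h | h <;> omega
      · exfalso
        rw [h0, zero_mul] at hrel'
        rcases lt_trichotomy k 0 with h1 | h1 | h1
        · have : k * q ≤ -q := by nlinarith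
          rcases hrel' with h | h <;> omega
        · rw [h1] at hrel'
          rcases hrel' with h | h <;> simp at h <;> omega
        · have : (q : ℤ) ≤ k * q := by nlinarith
          rcases hrel' with h | h <;> omega
      · left
        refine ⟨by omega, ?_⟩
        by_contra! hk0
        have h1 : k * q ≤ -q := by nlinarith
        have h2 : 0 ≤ m * Q' := mul_nonneg h0.le hQ'0
        rcases hrel' with h | h <;> omega
    have hge : 1 ≤ |(b * x - a)| * D := by
      rw [show |(b * x - a)| * D = |(b * x - a) * D| by rw [abs_mul, abs_of_pos hD0], e]
      rcases hmk with ⟨h1, h2⟩ | ⟨h1, h2⟩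
      · have h1' : (1 : ℝ) ≤ m := by exact_mod_cast h1
        have h2' : (0 : ℝ) ≤ k := by exact_mod_cast h2
        rw [abs_of_nonneg (by positivity)]
        nlinarith
      · have h1' : (m : ℝ) ≤ -1 := by exact_mod_cast h1
        have h2' : (k : ℝ) ≤ 0 := by exact_mod_cast h2
        have : t * (k : ℝ) ≤ 0 := mul_nonpos_of_nonneg_of_nonpos ht0.le h2'
        rw [abs_of_nonpos (by linarith)]
        linarith
    rw [div_le_iff₀ (by positivity)]
    calc 1 ≤ |(b * x - a)| * D := hge
      _ ≤ _ := by gcongr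

/-! ### Pointwise bounds for the theta function -/

section pointwise

variable {p : ℤ} {q : ℕ} {x y : ℝ}

lemma squareTheta_sub_rat (p : ℤ) (q : ℕ) (x y : ℝ) : squareTheta (x + y * Complex.I) =
    squareTheta (p / q + ((x - p / q : ℝ) + y * Complex.I)) := by
  congr 1
  push_cast
  ring

lemma norm_sq_ofReal_add_mul_I (h y : ℝ) : ‖(h : ℂ) + y * Complex.I‖ ^ 2 = h ^ 2 + y ^ 2 := by
  rw [← Complex.normSq_eq_norm_sq, Complex.normSq_add_mul_I]

lemma max_le_norm_add_mul_I {h y : ℝ} :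
    max |h| y ≤ ‖(h : ℂ) + y * Complex.I‖ := by
  refine max_le ?_ ?_
  · refine abs_le_of_sq_le_sq' ?_ (norm_nonneg _) |>.2
    rw [norm_sq_ofReal_add_mul_I, sq_abs]
    nlinarith
  · refine abs_le_of_sq_le_sq' ?_ (norm_nonneg _) |>.2
    rw [norm_sq_ofReal_add_mul_I]
    nlinarith

lemma norm_add_mul_I_le {h y : ℝ} (hy : 0 < y) : ‖(h : ℂ) + y * Complex.I‖ ≤ |h| + y := by
  refine (norm_add_le _ _).trans (le_of_eq ?_)
  rw [norm_mul, Complex.norm_I, mul_one, Complex.norm_real, Complex.norm_real, Real.norm_eq_abs,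
    Real.norm_of_nonneg hy.le]

lemma norm_squareTheta_le_gaussTheta (hq : 0 < q) (hpq : IsCoprime p (q : ℤ)) (hy : 0 < y) :
    ‖squareTheta (x + y * Complex.I)‖ ≤
      1 / Real.sqrt (q * ‖((x - p / q : ℝ) : ℂ) + y * Complex.I‖) *
      gaussTheta (y / ((q : ℝ) ^ 2 * ‖((x - p / q : ℝ) : ℂ) + y * Complex.I‖ ^ 2)) := by
  have : NeZero q := ⟨hq.ne'⟩
  have him : (((x - p / q : ℝ) : ℂ) + y * Complex.I).im = y := by simp
  have h := norm_squareTheta_rat_add_le q p hpq (τ := ((x - p / q : ℝ) : ℂ) + y * Complex.I)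
    (by rw [him]; exact hy)
  rwa [← squareTheta_sub_rat, him] at h

/-- The theta function at height `y` above a point within `1/q² + 2y` of `p/q`. -/
lemma norm_squareTheta_le_of_near (hq : 0 < q) (hpq : IsCoprime p (q : ℤ)) (hy : 0 < y)
    (hx : |x - p / q| ≤ 1 / (q : ℝ) ^ 2 + 2 * y) :
    ‖squareTheta (x + y * Complex.I)‖ ≤ 9 / Real.sqrt (q * y) + 12 * Real.sqrt q := by
  have hq0 : (0 : ℝ) < q := by exact_mod_cast hq
  refine (norm_squareTheta_le_gaussTheta hq hpq hy).trans ?_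
  have h1 := max_le_norm_add_mul_I (h := x - p / q) (y := y)
  have h2 := norm_add_mul_I_le (h := x - p / q) hy
  set T := ‖((x - p / q : ℝ) : ℂ) + y * Complex.I‖ with hT
  have hyT : y ≤ T := (le_max_right _ _).trans h1
  have hT0 : 0 < T := hy.trans_le hyT
  have hT3 : T ≤ 1 / (q : ℝ) ^ 2 + 3 * y := by linarith
  have hg := gaussTheta_le_sqrt (w := y / ((q : ℝ) ^ 2 * T ^ 2)) (by positivity)
  have e1 : Real.sqrt (y / ((q : ℝ) ^ 2 * T ^ 2)) = Real.sqrt y / (q * T) := by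
    rw [Real.sqrt_div hy.le, ← mul_pow, Real.sqrt_sq (by positivity)]
  rw [e1] at hg
  have hsy : 0 < Real.sqrt y := by positivity
  have hsq : 0 < Real.sqrt q := by positivity
  have hsT : 0 < Real.sqrt (q * T) := by positivity
  have e2 : 1 / Real.sqrt (q * T) * (3 + 6 / (Real.sqrt y / (q * T))) =
      3 / Real.sqrt (q * T) + 6 * Real.sqrt (q * T) / Real.sqrt y := by
    have := Real.mul_self_sqrt (by positivity : 0 ≤ q * T)
    field_simp
    nlinarith
  have e3 : 3 / Real.sqrt (q * T) ≤ 3 / Real.sqrt (q * y) := by gcongr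
  have e4 : Real.sqrt (q * T) ≤ 1 / Real.sqrt q + 2 * Real.sqrt q * Real.sqrt y := by
    apply Real.sqrt_le_iff.2
    refine ⟨by positivity, ?_⟩
    have hs1 := Real.sq_sqrt hq0.le
    have hs2 := Real.sq_sqrt hy.le
    calc q * T ≤ q * (1 / (q : ℝ) ^ 2 + 3 * y) := by gcongr
      _ = 1 / q + 3 * (q * y) := by field_simp
      _ ≤ 1 / q + 4 * (q * y) + 4 * Real.sqrt y := by nlinarith [mul_pos hq0 hy]
      _ = (1 / Real.sqrt q + 2 * Real.sqrt q * Real.sqrt y) ^ 2 := by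
        rw [add_sq, div_pow, mul_pow, mul_pow, hs1, hs2]
        field_simp
        ring
  have e5 : 6 * Real.sqrt (q * T) / Real.sqrt y ≤ 6 / Real.sqrt (q * y) + 12 * Real.sqrt q := by
    rw [div_le_iff₀ hsy, Real.sqrt_mul hq0.le y]
    have : (6 / (Real.sqrt q * Real.sqrt y) + 12 * Real.sqrt q) * Real.sqrt y =
      6 * (1 / Real.sqrt q + 2 * Real.sqrt q * Real.sqrt y) := by field_simp; ring
    rw [this]
    gcongr
  calc _ ≤ 1 / Real.sqrt (q * T) * (3 + 6 / (Real.sqrt y / (q * T))) := by gcongr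
    _ ≤ 3 / Real.sqrt (q * y) + (6 / Real.sqrt (q * y) + 12 * Real.sqrt q) := by
      rw [e2]; gcongr
    _ = _ := by ring

/-- The sharp form of the bound for the theta function near a rational point. -/
lemma norm_squareTheta_le_main (hq : 0 < q) (hpq : IsCoprime p (q : ℤ)) (hy : 0 < y) :
    ‖squareTheta (x + y * Complex.I)‖ ≤ 1 / Real.sqrt (q * max |x - p / q| y) +
      9 * ((q * max |x - p / q| y) * Real.sqrt (q * max |x - p / q| y)) / y := by
  have hq0 : (0 : ℝ) < q := by exact_mod_cast hq
  refine (norm_squareTheta_le_gaussTheta hq hpq hy).trans ?_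
  have h1 := max_le_norm_add_mul_I (h := x - p / q) (y := y)
  have h2 := norm_add_mul_I_le (h := x - p / q) hy
  set T := ‖((x - p / q : ℝ) : ℂ) + y * Complex.I‖ with hT
  set m := max |x - p / q| y with hm
  have hm0 : 0 < m := hy.trans_le (le_max_right _ _)
  have hT0 : 0 < T := hm0.trans_le h1
  have hT2 : T ≤ 2 * m := by
    have := le_max_left |x - p / q| y
    have := le_max_right |x - p / q| y
    linarith
  have hg := gaussTheta_le_one_add (w := y / ((q : ℝ) ^ 2 * T ^ 2)) (by positivity)
  have e2 : 1 / Real.sqrt (q * T) * (1 + 3 / (y / ((q : ℝ) ^ 2 * T ^ 2))) =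
      1 / Real.sqrt (q * T) + 3 * ((q * T) * Real.sqrt (q * T)) / y := by
    have hs := Real.mul_self_sqrt (by positivity : 0 ≤ q * T)
    have hs0 : 0 < Real.sqrt (q * T) := by positivity
    field_simp
    rw [show Real.sqrt (q * T) ^ 2 = q * T by rw [sq, hs]]
    ring
  calc _ ≤ 1 / Real.sqrt (q * T) * (1 + 3 / (y / ((q : ℝ) ^ 2 * T ^ 2))) := by gcongr
    _ = 1 / Real.sqrt (q * T) + 3 * ((q * T) * Real.sqrt (q * T)) / y := e2
    _ ≤ 1 / Real.sqrt (q * m) + 3 * ((q * (2 * m)) * Real.sqrt (q * (2 * m))) / y := by gcongr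
    _ ≤ _ := by
      refine add_le_add le_rfl (div_le_div_of_nonneg_right ?_ hy.le)
      have : Real.sqrt (q * (2 * m)) ≤ 3 / 2 * Real.sqrt (q * m) := by
        apply Real.sqrt_le_iff.2
        refine ⟨by positivity, ?_⟩
        rw [mul_pow, Real.sq_sqrt (by positivity)]
        nlinarith [mul_pos hq0 hm0]
      calc _ ≤ 3 * ((q * (2 * m)) * (3 / 2 * Real.sqrt (q * m))) := by gcongr
        _ = _ := by ring

/-- The theta function at a height at which `p/q` is a good approximation. -/
lemma norm_squareTheta_le_of_sq_le (hq : 0 < q) (hpq : IsCoprime p (q : ℤ)) (hy : 0 < y)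
    (h1 : (q : ℝ) ^ 2 * (x - p / q) ^ 2 ≤ y) (h2 : (q : ℝ) ^ 2 * y ≤ 1) :
    ‖squareTheta (x + y * Complex.I)‖ ≤ 10 / Real.sqrt (q * max |x - p / q| y) := by
  have hq0 : (0 : ℝ) < q := by exact_mod_cast hq
  refine (norm_squareTheta_le_main hq hpq hy).trans ?_
  set m := max |x - p / q| y with hm
  have hm0 : 0 < m := hy.trans_le (le_max_right _ _)
  have hm2 : (q : ℝ) ^ 2 * m ^ 2 ≤ y := by
    rcases max_choice |x - p / q| y with h | h
    · rw [hm, h, sq_abs]; exact h1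
    · rw [hm, h]; nlinarith
  have hs := Real.sq_sqrt (by positivity : 0 ≤ q * m)
  have hs0 : 0 < Real.sqrt (q * m) := by positivity
  have : 9 * ((q * m) * Real.sqrt (q * m)) / y ≤ 9 / Real.sqrt (q * m) := by
    rw [div_le_div_iff₀ hy hs0]
    calc 9 * ((q * m) * Real.sqrt (q * m)) * Real.sqrt (q * m) = 9 * (q ^ 2 * m ^ 2) := by
          rw [mul_assoc, mul_assoc, ← sq, hs]; ring
      _ ≤ 9 * y := by gcongr
  calc _ ≤ 1 / Real.sqrt (q * m) + 9 / Real.sqrt (q * m) := by gcongr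
    _ = _ := by ring

end pointwise

/-! ### Oscillation of the theta integral at large heights -/

lemma norm_deriv_squareTheta_le {p : ℤ} {q : ℕ} {u y : ℝ} (hq : 0 < q) (hpq : IsCoprime p (q : ℤ))
    (hy : 0 < y) (hu : |u - p / q| ≤ 1 / (q : ℝ) ^ 2) :
    ‖deriv squareTheta (u + y * Complex.I)‖ ≤
      (36 / Real.sqrt (q * y) + 24 * Real.sqrt q) / y := by
  have hq0 : (0 : ℝ) < q := by exact_mod_cast hq
  have him : ∀ z ∈ Metric.closedBall (u + y * Complex.I) (y / 2), y / 2 ≤ z.im ∧ |z.re - u| ≤ y / 2 := by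
    intro z hz
    rw [Metric.mem_closedBall, dist_eq_norm] at hz
    have h1 := (Complex.abs_im_le_norm _).trans hz
    have h2 := (Complex.abs_re_le_norm _).trans hz
    simp at h1 h2
    exact ⟨by linarith [(abs_le.1 h1).1], h2⟩
  have hC : ∀ z ∈ Metric.sphere (u + y * Complex.I) (y / 2),
      ‖squareTheta z‖ ≤ 18 / Real.sqrt (q * y) + 12 * Real.sqrt q := by
    intro z hz
    obtain ⟨h1, h2⟩ := him z (Metric.sphere_subset_closedBall hz)
    have hz' : z = (z.re : ℂ) + z.im * Complex.I := (Complex.re_add_im z).symm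
    have h3 : |z.re - p / q| ≤ 1 / (q : ℝ) ^ 2 + 2 * z.im := by
      calc |z.re - p / q| = |(z.re - u) + (u - p / q)| := by ring_nf
        _ ≤ |z.re - u| + |u - p / q| := abs_add_le _ _
        _ ≤ _ := by linarith
    rw [hz']
    refine (norm_squareTheta_le_of_near hq hpq (by linarith) h3).trans ?_
    gcongr ?_ + _
    rw [div_le_div_iff₀ (Real.sqrt_pos.2 (mul_pos hq0 (by linarith))) (by positivity)]
    have : Real.sqrt (q * y) ≤ 2 * Real.sqrt (q * z.im) := by
      apply Real.sqrt_le_iff.2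
      refine ⟨by positivity, ?_⟩
      rw [mul_pow, Real.sq_sqrt (mul_nonneg hq0.le (by linarith))]
      nlinarith
    linarith
  have hd : DiffContOnCl ℂ squareTheta (Metric.ball (u + y * Complex.I) (y / 2)) := by
    apply DifferentiableOn.diffContOnCl
    intro z hz
    have := him z (Metric.closure_ball_subset_closedBall hz)
    exact (differentiableAt_squareTheta (by linarith)).differentiableWithinAt
  refine (Complex.norm_deriv_le_of_forall_mem_sphere_norm_le (by positivity) hd hC).trans
    (le_of_eq ?_)
  field_simp
  ring

lemma norm_squareTheta_sub_le {p : ℤ} {q : ℕ} {x x₀ y : ℝ} (hq : 0 < q) (hpq : IsCoprime p (q : ℤ))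
    (hy : 0 < y) (hx : |x - p / q| ≤ 1 / (q : ℝ) ^ 2) (hx₀ : |x₀ - p / q| ≤ 1 / (q : ℝ) ^ 2) :
    ‖squareTheta (x + y * Complex.I) - squareTheta (x₀ + y * Complex.I)‖ ≤
      (36 / Real.sqrt (q * y) + 24 * Real.sqrt q) / y * |x - x₀| := by
  set s : Set ℝ := Set.Icc (p / q - 1 / (q : ℝ) ^ 2) (p / q + 1 / (q : ℝ) ^ 2) with hs
  have hmem : ∀ u : ℝ, u ∈ s ↔ |u - p / q| ≤ 1 / (q : ℝ) ^ 2 := by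
    intro u
    rw [hs, Set.mem_Icc, abs_le]
    constructor <;> rintro ⟨h1, h2⟩ <;> constructor <;> linarith
  have hder : ∀ u : ℝ, HasDerivAt (fun u : ℝ => squareTheta (u + y * Complex.I))
      (deriv squareTheta (u + y * Complex.I)) u := by
    intro u
    have h1 : HasDerivAt squareTheta (deriv squareTheta (u + y * Complex.I)) (u + y * Complex.I) :=
      (differentiableAt_squareTheta (by simpa using hy)).hasDerivAt
    have h2 : HasDerivAt (fun u : ℝ => (u : ℂ) + y * Complex.I) 1 u :=
      (Complex.ofRealCLM.hasDerivAt (x := u)).add_const _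
    have h3 := h1.comp u h2
    rw [mul_one] at h3
    exact h3
  have := (convex_Icc (p / q - 1 / (q : ℝ) ^ 2) (p / q + 1 / (q : ℝ) ^ 2)).norm_image_sub_le_of_norm_deriv_le
    (f := fun u : ℝ => squareTheta (u + y * Complex.I))
    (C := (36 / Real.sqrt (q * y) + 24 * Real.sqrt q) / y)
    (fun u _ => (hder u).differentiableAt) (fun u hu => by
      rw [(hder u).deriv]
      exact norm_deriv_squareTheta_le hq hpq hy ((hmem u).1 hu)) ((hmem x₀).2 hx₀) ((hmem x).2 hx)
  simpa [Real.norm_eq_abs] using this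

/-- The mass `∫_s |θ(x + iy)| y^{-1/2} dy`. -/
noncomputable def thetaMass (x : ℝ) (s : Set ℝ) : ENNReal :=
  ∫⁻ y in s, ‖squareTheta (x + y * Complex.I)‖ₑ * ENNReal.ofReal (y ^ (-(1 / 2) : ℝ))

lemma rpow_neg_half {y : ℝ} (hy : 0 < y) : y ^ (-(1 / 2) : ℝ) = 1 / Real.sqrt y := by
  rw [Real.rpow_neg hy.le, Real.sqrt_eq_rpow, one_div (y ^ _)]

lemma lintegral_norm_squareTheta_sub_le {p : ℤ} {q : ℕ} {x x₀ L : ℝ} (hq : 0 < q)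
    (hpq : IsCoprime p (q : ℤ)) (hL : 0 < L) (hLq : L ≤ 2 / (q : ℝ) ^ 2)
    (hx : |x - p / q| ≤ 1 / (q : ℝ) ^ 2) (hx₀ : |x₀ - p / q| ≤ 1 / (q : ℝ) ^ 2)
    (hxx : |x - x₀| ≤ L) :
    ∫⁻ y in Set.Ioi L, ‖squareTheta (x + y * Complex.I) - squareTheta (x₀ + y * Complex.I)‖ₑ *
      ENNReal.ofReal (y ^ (-(1 / 2) : ℝ)) ≤ ENNReal.ofReal (108 / Real.sqrt q) := by
  have hq0 : (0 : ℝ) < q := by exact_mod_cast hq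
  have hsq : 0 < Real.sqrt q := by positivity
  have hi1 : IntegrableOn (fun y : ℝ => y ^ (-2 : ℝ)) (Set.Ioi L) :=
    integrableOn_Ioi_rpow_of_lt (by norm_num) hL
  have hi2 : IntegrableOn (fun y : ℝ => y ^ (-(3 / 2) : ℝ)) (Set.Ioi L) :=
    integrableOn_Ioi_rpow_of_lt (by norm_num) hL
  have hpt : ∀ y ∈ Set.Ioi L,
      ‖squareTheta (x + y * Complex.I) - squareTheta (x₀ + y * Complex.I)‖ₑ *
      ENNReal.ofReal (y ^ (-(1 / 2) : ℝ)) ≤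
      ENNReal.ofReal (L * (36 / Real.sqrt q) * y ^ (-2 : ℝ) +
        L * (24 * Real.sqrt q) * y ^ (-(3 / 2) : ℝ)) := by
    intro y (hy : L < y)
    have hy0 : 0 < y := hL.trans hy
    rw [← ofReal_norm, ← ENNReal.ofReal_mul (norm_nonneg _)]
    apply ENNReal.ofReal_le_ofReal
    have h := norm_squareTheta_sub_le hq hpq hy0 hx hx₀
    have hsy : 0 < Real.sqrt y := by positivity
    have e1 : y ^ (-2 : ℝ) = 1 / y ^ 2 := by
      rw [Real.rpow_neg hy0.le, one_div]
      norm_cast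
    have e2 : y ^ (-(3 / 2) : ℝ) = 1 / (y * Real.sqrt y) := by
      rw [show (-(3 / 2) : ℝ) = -1 + -(1 / 2) by norm_num, Real.rpow_add hy0, rpow_neg_half hy0,
        Real.rpow_neg_one]
      field_simp
    rw [rpow_neg_half hy0, e1, e2]
    calc _ ≤ (36 / Real.sqrt (q * y) + 24 * Real.sqrt q) / y * L * (1 / Real.sqrt y) := by
          gcongr
          exact h.trans (by gcongr)
      _ = _ := by
          rw [Real.sqrt_mul hq0.le]
          have := Real.sq_sqrt hy0.le
          field_simp
          linear_combination -36 * this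
  refine (setLIntegral_mono' measurableSet_Ioi hpt).trans ?_
  have hi12 : IntegrableOn (fun y : ℝ => L * (36 / Real.sqrt q) * y ^ (-2 : ℝ) +
      L * (24 * Real.sqrt q) * y ^ (-(3 / 2) : ℝ)) (Set.Ioi L) :=
    (hi1.const_mul _).add (hi2.const_mul _)
  rw [← ofReal_integral_eq_lintegral_ofReal hi12]
  · apply ENNReal.ofReal_le_ofReal
    rw [integral_add (hi1.const_mul _) (hi2.const_mul _), integral_const_mul, integral_const_mul,
      integral_Ioi_rpow_of_lt (by norm_num) hL, integral_Ioi_rpow_of_lt (by norm_num) hL]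
    norm_num
    rw [Real.rpow_neg_one, show (-(1 / 2) : ℝ) = -(1 / 2) by rfl, rpow_neg_half hL]
    have hsL : 0 < Real.sqrt L := by positivity
    have e3 : L * (36 / Real.sqrt q) * L⁻¹ = 36 / Real.sqrt q := by field_simp
    have e4 : L * (24 * Real.sqrt q) * ((1 / Real.sqrt L) * 2) = 48 * Real.sqrt q * Real.sqrt L := by
      have := Real.mul_self_sqrt hL.le
      field_simp
      nlinarith
    have e5 : Real.sqrt L ≤ 3 / 2 / q := by
      apply Real.sqrt_le_iff.2
      refine ⟨by positivity, hLq.trans ?_⟩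
      rw [div_pow]
      gcongr
      norm_num
    have e6 : 48 * Real.sqrt q * Real.sqrt L ≤ 72 / Real.sqrt q := by
      calc _ ≤ 48 * Real.sqrt q * (3 / 2 / q) := by gcongr
        _ = 72 / Real.sqrt q := by
          have := Real.mul_self_sqrt hq0.le
          field_simp
          nlinarith
    rw [e3]
    have e7 : (108 : ℝ) / Real.sqrt q = 36 / Real.sqrt q + 72 / Real.sqrt q := by ring
    rw [e7]
    refine add_le_add le_rfl (le_trans (le_of_eq ?_) e6)
    rw [← e4]
    ring
  · filter_upwards [ae_restrict_mem measurableSet_Ioi] with y hy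
    have : 0 < y := hL.trans hy
    positivity

lemma thetaMass_Ioc_le {p : ℤ} {q : ℕ} {x L y₀ : ℝ} (hq : 0 < q)
    (hpq : IsCoprime p (q : ℤ)) (hy₀ : 0 < y₀) (hyL : y₀ ≤ L) (hLq : L ≤ 2 / (q : ℝ) ^ 2)
    (hx : |x - p / q| ≤ 1 / (q : ℝ) ^ 2) :
    thetaMass x (Set.Ioc y₀ L) ≤ ENNReal.ofReal ((9 * Real.log (L / y₀) + 36) / Real.sqrt q) := by
  have hL : 0 < L := hy₀.trans_le hyL
  have hq0 : (0 : ℝ) < q := by exact_mod_cast hq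
  have hsq : 0 < Real.sqrt q := by positivity
  have hi1 : IntervalIntegrable (fun y : ℝ => y⁻¹) volume y₀ L :=
    intervalIntegrable_inv_iff.2 (Or.inr (by
      rw [Set.uIcc_of_le hyL]; intro h; exact absurd h.1 (not_le.2 hy₀)))
  have hi2 : IntervalIntegrable (fun y : ℝ => y ^ (-(1 / 2) : ℝ)) volume 0 L :=
    intervalIntegral.intervalIntegrable_rpow' (by norm_num)
  have hi2' : IntervalIntegrable (fun y : ℝ => y ^ (-(1 / 2) : ℝ)) volume y₀ L :=
    intervalIntegral.intervalIntegrable_rpow' (by norm_num)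
  have hpt : ∀ y ∈ Set.Ioc y₀ L,
      ‖squareTheta (x + y * Complex.I)‖ₑ * ENNReal.ofReal (y ^ (-(1 / 2) : ℝ)) ≤
      ENNReal.ofReal ((9 / Real.sqrt q) * y⁻¹ + (12 * Real.sqrt q) * y ^ (-(1 / 2) : ℝ)) := by
    rintro y ⟨hy, -⟩
    have hy0 : 0 < y := hy₀.trans hy
    rw [← ofReal_norm, ← ENNReal.ofReal_mul (norm_nonneg _)]
    apply ENNReal.ofReal_le_ofReal
    have h := norm_squareTheta_le_of_near (x := x) hq hpq hy0 (by linarith)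
    have hsy : 0 < Real.sqrt y := by positivity
    rw [rpow_neg_half hy0]
    calc _ ≤ (9 / Real.sqrt (q * y) + 12 * Real.sqrt q) * (1 / Real.sqrt y) := by gcongr
      _ = _ := by
        rw [Real.sqrt_mul hq0.le]
        have := Real.mul_self_sqrt hy0.le
        field_simp
        nlinarith
  refine (setLIntegral_mono' measurableSet_Ioc hpt).trans ?_
  rw [← ofReal_integral_eq_lintegral_ofReal]
  · apply ENNReal.ofReal_le_ofReal
    rw [← intervalIntegral.integral_of_le hyL,
      intervalIntegral.integral_add (hi1.const_mul _) (hi2'.const_mul _),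
      intervalIntegral.integral_const_mul, intervalIntegral.integral_const_mul,
      integral_inv_of_pos hy₀ hL, integral_rpow (Or.inl (by norm_num))]
    norm_num
    simp only [← Real.sqrt_eq_rpow]
    have e5 : Real.sqrt L ≤ 3 / 2 / q := by
      apply Real.sqrt_le_iff.2
      refine ⟨by positivity, hLq.trans ?_⟩
      rw [div_pow]
      gcongr
      norm_num
    have e6 : 24 * Real.sqrt q * Real.sqrt L ≤ 36 / Real.sqrt q := by
      calc _ ≤ 24 * Real.sqrt q * (3 / 2 / q) := by gcongr
        _ = 36 / Real.sqrt q := by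
          have := Real.mul_self_sqrt hq0.le
          field_simp
          nlinarith
    have hs0 : 0 ≤ Real.sqrt y₀ := Real.sqrt_nonneg _
    have e7 : (9 * Real.log (L / y₀) + 36) / Real.sqrt q =
      9 / Real.sqrt q * Real.log (L / y₀) + 36 / Real.sqrt q := by ring
    rw [e7]
    have : 0 ≤ Real.sqrt q * Real.sqrt y₀ := by positivity
    nlinarith
  · have := (hi1.const_mul (9 / Real.sqrt q)).add (hi2'.const_mul (12 * Real.sqrt q))
    exact (intervalIntegrable_iff_integrableOn_Ioc_of_le hyL).1 this
  · filter_upwards [ae_restrict_mem measurableSet_Ioc] with y hy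
    have : 0 < y := hy₀.trans hy.1
    positivity

/-- The integrand defining `thetaIntegral x` is integrable. -/
def ThetaIntegrable (x : ℝ) : Prop :=
  IntegrableOn (fun y : ℝ => (squareTheta (x + y * Complex.I) - 1) *
      ((y ^ (-(1 / 2) : ℝ) : ℝ) : ℂ)) (Set.Ioi 0)

/-- The constant by which `thetaIntegral` is approximated at distance `L` from `x₀`. -/
noncomputable def thetaCenter (x₀ L : ℝ) : ℂ :=
  ((1 / Real.sqrt 2 : ℝ) : ℂ) *
    ((∫ y in Set.Ioi L, (squareTheta (x₀ + y * Complex.I) - 1) * ((y ^ (-(1 / 2) : ℝ) : ℝ) : ℂ)) -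
      ∫ y in Set.Ioc 0 L, ((y ^ (-(1 / 2) : ℝ) : ℝ) : ℂ))

lemma enorm_mul_rpow_neg_half {w : ℂ} {y : ℝ} (hy : 0 < y) :
    ‖w * ((y ^ (-(1 / 2) : ℝ) : ℝ) : ℂ)‖ₑ = ‖w‖ₑ * ENNReal.ofReal (y ^ (-(1 / 2) : ℝ)) := by
  rw [enorm_mul]
  congr 1
  rw [← ofReal_norm, Complex.norm_real, Real.norm_of_nonneg (by positivity)]

lemma enorm_thetaIntegral_sub_center_le {p : ℤ} {q : ℕ} {x x₀ L y₀ : ℝ} (hq : 0 < q)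
    (hpq : IsCoprime p (q : ℤ)) (hy₀ : 0 < y₀) (hyL : y₀ ≤ L) (hLq : L ≤ 2 / (q : ℝ) ^ 2)
    (hx : |x - p / q| ≤ 1 / (q : ℝ) ^ 2) (hx₀ : |x₀ - p / q| ≤ 1 / (q : ℝ) ^ 2)
    (hxx : |x - x₀| ≤ L) (hint : ThetaIntegrable x) (hint₀ : ThetaIntegrable x₀) :
    ‖thetaIntegral x - thetaCenter x₀ L‖ₑ ≤
      ENNReal.ofReal ((9 * Real.log (L / y₀) + 144) / Real.sqrt q) +
      ENNReal.ofReal (1 / Real.sqrt 2) * thetaMass x (Set.Ioc 0 y₀) := by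
  have hL : 0 < L := hy₀.trans_le hyL
  have hq0 : (0 : ℝ) < q := by exact_mod_cast hq
  have hi1 := hint.mono_set (Set.Ioi_subset_Ioi hL.le)
  have hi2 := hint.mono_set (Set.Ioc_subset_Ioi_self : Set.Ioc 0 L ⊆ Set.Ioi 0)
  have hi3 := hint₀.mono_set (Set.Ioi_subset_Ioi hL.le)
  have hi4 : IntegrableOn (fun y : ℝ => ((y ^ (-(1 / 2) : ℝ) : ℝ) : ℂ)) (Set.Ioc 0 L) := by
    refine Integrable.ofReal ?_
    exact (intervalIntegrable_iff_integrableOn_Ioc_of_le hL.le).1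
      (intervalIntegral.intervalIntegrable_rpow' (by norm_num))
  have hsplit : thetaIntegral x - thetaCenter x₀ L = ((1 / Real.sqrt 2 : ℝ) : ℂ) *
      ((∫ y in Set.Ioi L, (squareTheta (x + y * Complex.I) - squareTheta (x₀ + y * Complex.I)) *
        ((y ^ (-(1 / 2) : ℝ) : ℝ) : ℂ)) +
       ∫ y in Set.Ioc 0 L, squareTheta (x + y * Complex.I) * ((y ^ (-(1 / 2) : ℝ) : ℝ) : ℂ)) := by
    have e1 : ∫ y in Set.Ioi L,
        (squareTheta (x + y * Complex.I) - squareTheta (x₀ + y * Complex.I)) *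
        ((y ^ (-(1 / 2) : ℝ) : ℝ) : ℂ) =
        (∫ y in Set.Ioi L, (squareTheta (x + y * Complex.I) - 1) * ((y ^ (-(1 / 2) : ℝ) : ℝ) : ℂ)) -
        ∫ y in Set.Ioi L, (squareTheta (x₀ + y * Complex.I) - 1) * ((y ^ (-(1 / 2) : ℝ) : ℝ) : ℂ) := by
      rw [← integral_sub hi1 hi3]
      refine integral_congr_ae (Eventually.of_forall fun y => ?_)
      simp only
      ring
    have e2 : ∫ y in Set.Ioc 0 L, squareTheta (x + y * Complex.I) * ((y ^ (-(1 / 2) : ℝ) : ℝ) : ℂ) =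
        (∫ y in Set.Ioc 0 L, (squareTheta (x + y * Complex.I) - 1) *
          ((y ^ (-(1 / 2) : ℝ) : ℝ) : ℂ)) + ∫ y in Set.Ioc 0 L, ((y ^ (-(1 / 2) : ℝ) : ℝ) : ℂ) := by
      rw [← integral_add hi2 hi4]
      refine integral_congr_ae (Eventually.of_forall fun y => ?_)
      simp only
      ring
    rw [thetaIntegral, thetaCenter, e1, e2, ← Set.Ioc_union_Ioi_eq_Ioi hL.le,
      setIntegral_union (Set.Ioc_disjoint_Ioi le_rfl) measurableSet_Ioi hi2 hi1]
    ring
  have hc : ‖((1 / Real.sqrt 2 : ℝ) : ℂ)‖ₑ = ENNReal.ofReal (1 / Real.sqrt 2) := by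
    rw [← ofReal_norm, Complex.norm_real, Real.norm_of_nonneg (by positivity)]
  have hc1 : ENNReal.ofReal (1 / Real.sqrt 2) ≤ 1 := by
    rw [ENNReal.ofReal_le_one, div_le_one (by positivity)]
    exact Real.one_le_sqrt.2 (by norm_num)
  have hA : ‖∫ y in Set.Ioi L, (squareTheta (x + y * Complex.I) - squareTheta (x₀ + y * Complex.I)) *
        ((y ^ (-(1 / 2) : ℝ) : ℝ) : ℂ)‖ₑ ≤ ENNReal.ofReal (108 / Real.sqrt q) := by
    refine (enorm_integral_le_lintegral_enorm _).trans (le_trans (le_of_eq ?_)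
      (lintegral_norm_squareTheta_sub_le hq hpq hL hLq hx hx₀ hxx))
    exact setLIntegral_congr_fun measurableSet_Ioi fun y hy => enorm_mul_rpow_neg_half (hL.trans hy)
  have hB : ‖∫ y in Set.Ioc 0 L, squareTheta (x + y * Complex.I) *
      ((y ^ (-(1 / 2) : ℝ) : ℝ) : ℂ)‖ₑ ≤ thetaMass x (Set.Ioc 0 y₀) +
        ENNReal.ofReal ((9 * Real.log (L / y₀) + 36) / Real.sqrt q) := by
    calc _ ≤ thetaMass x (Set.Ioc 0 L) := by
          refine (enorm_integral_le_lintegral_enorm _).trans (le_of_eq ?_)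
          exact setLIntegral_congr_fun measurableSet_Ioc fun y hy => enorm_mul_rpow_neg_half hy.1
      _ = thetaMass x (Set.Ioc 0 y₀) + thetaMass x (Set.Ioc y₀ L) := by
          rw [thetaMass, ← Set.Ioc_union_Ioc_eq_Ioc hy₀.le hyL,
            lintegral_union measurableSet_Ioc (Set.Ioc_disjoint_Ioc_of_le le_rfl)]
          rfl
      _ ≤ _ := by
          gcongr
          exact thetaMass_Ioc_le hq hpq hy₀ hyL hLq hx
  have hlog : 0 ≤ Real.log (L / y₀) := Real.log_nonneg ((one_le_div hy₀).2 hyL)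
  rw [hsplit, enorm_mul, hc]
  calc _ ≤ ENNReal.ofReal (1 / Real.sqrt 2) * (ENNReal.ofReal (108 / Real.sqrt q) +
        (thetaMass x (Set.Ioc 0 y₀) +
          ENNReal.ofReal ((9 * Real.log (L / y₀) + 36) / Real.sqrt q))) := by
        gcongr
        exact (enorm_add_le _ _).trans (add_le_add hA hB)
    _ = ENNReal.ofReal (1 / Real.sqrt 2) * (ENNReal.ofReal (108 / Real.sqrt q) +
          ENNReal.ofReal ((9 * Real.log (L / y₀) + 36) / Real.sqrt q)) +
        ENNReal.ofReal (1 / Real.sqrt 2) * thetaMass x (Set.Ioc 0 y₀) := by ring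
    _ ≤ 1 * (ENNReal.ofReal (108 / Real.sqrt q) +
          ENNReal.ofReal ((9 * Real.log (L / y₀) + 36) / Real.sqrt q)) +
        ENNReal.ofReal (1 / Real.sqrt 2) * thetaMass x (Set.Ioc 0 y₀) := by gcongr
    _ = _ := by
        rw [one_mul, ← ENNReal.ofReal_add (by positivity) (by positivity)]
        congr 2
        ring

/-! ### Points that avoid the neighbourhoods of fractions -/

/-- The radius excluded around the fractions with denominators in `[16^l N, 16^(l+1) N)`. -/
noncomputable def excludedRadius (N K : ℝ) (l : ℕ) : ℝ :=
  Real.exp (-(2 ^ l * K)) / (16 ^ l * N) ^ 2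

/-- The points that are very close to a fraction with a denominator at least `N`. -/
def wellApproxSet (N K : ℝ) : Set ℝ :=
  {x | ∃ (l : ℕ) (r : ℚ), 16 ^ l * N ≤ r.den ∧ (r.den : ℝ) < 16 ^ (l + 1) * N ∧
    |x - r| < excludedRadius N K l}

lemma Rat.one_le_abs_sub_mul_den {r s : ℚ} (h : r ≠ s) :
    (1 : ℝ) ≤ |(r : ℝ) - s| * (r.den * s.den) := by
  have hr : (0 : ℝ) < r.den := by exact_mod_cast r.den_pos
  have hs : (0 : ℝ) < s.den := by exact_mod_cast s.den_pos
  have e : ((r : ℝ) - s) * (r.den * s.den) = ((r.num * s.den - s.num * r.den : ℤ) : ℝ) := by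
    rw [Rat.cast_def r, Rat.cast_def s]
    push_cast
    field_simp
  rw [show |(r : ℝ) - s| * (r.den * s.den) = |((r : ℝ) - s) * (r.den * s.den)| by
    rw [abs_mul, abs_of_pos (mul_pos hr hs)], e, ← Int.cast_abs]
  have hne : r.num * s.den - s.num * r.den ≠ 0 := by
    intro h0
    rw [h0, Int.cast_zero, mul_eq_zero] at e
    rcases e with e | e
    · exact h (by exact_mod_cast sub_eq_zero.1 e)
    · exact absurd e (by positivity)
  exact_mod_cast Int.one_le_abs hne

/-- Dirichlet's theorem at the scale adapted to the height `y`. -/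
lemma exists_rat_den_sq_mul_le (x : ℝ) {y : ℝ} (hy : 0 < y) (hy1 : y ≤ 1) :
    ∃ r : ℚ, (r.den : ℝ) ^ 2 * y ≤ 1 ∧ (r.den : ℝ) * |x - r| ≤ Real.sqrt y := by
  have hs : 0 < Real.sqrt y := by positivity
  have hs1 : Real.sqrt y ≤ 1 := Real.sqrt_le_one.2 hy1
  set n := ⌊1 / Real.sqrt y⌋₊ with hn
  have hn0 : 0 < n := Nat.floor_pos.2 (by rw [le_div_iff₀ hs]; linarith)
  obtain ⟨r, h1, h2⟩ := Real.exists_rat_abs_sub_le_and_den_le x hn0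
  have hr : (0 : ℝ) < r.den := by exact_mod_cast r.den_pos
  refine ⟨r, ?_, ?_⟩
  · have h3 : (r.den : ℝ) ≤ 1 / Real.sqrt y :=
      le_trans (by exact_mod_cast h2) (Nat.floor_le (by positivity))
    calc (r.den : ℝ) ^ 2 * y ≤ (1 / Real.sqrt y) ^ 2 * y := by gcongr
      _ = 1 := by rw [div_pow, Real.sq_sqrt hy.le]; field_simp
  · have h3 : 1 / Real.sqrt y < n + 1 := Nat.lt_floor_add_one _
    calc (r.den : ℝ) * |x - r| ≤ r.den * (1 / ((n + 1) * r.den)) := by gcongr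
      _ = 1 / ((n : ℝ) + 1) := by field_simp
      _ ≤ Real.sqrt y := by
        rw [div_le_iff₀ (by positivity)]
        rw [div_lt_iff₀ hs] at h3
        linarith

lemma lintegral_rpow_neg_half_max_le {ρ Y : ℝ} (hρ : 0 < ρ) (hY : 0 < Y) :
    ∫⁻ y in Set.Ioc 0 Y, ENNReal.ofReal (1 / Real.sqrt (max ρ y) * y ^ (-(1 / 2) : ℝ)) ≤
      ENNReal.ofReal (2 + max 0 (Real.log (Y / ρ))) := by
  have h1 : ∫⁻ y in Set.Ioc 0 ρ, ENNReal.ofReal (1 / Real.sqrt (max ρ y) * y ^ (-(1 / 2) : ℝ)) ≤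
      ENNReal.ofReal 2 := by
    have e : ∀ y ∈ Set.Ioc 0 ρ, ENNReal.ofReal (1 / Real.sqrt (max ρ y) * y ^ (-(1 / 2) : ℝ)) =
        ENNReal.ofReal (1 / Real.sqrt ρ * y ^ (-(1 / 2) : ℝ)) := by
      intro y hy
      rw [max_eq_left hy.2]
    rw [setLIntegral_congr_fun measurableSet_Ioc e]
    have hi : IntervalIntegrable (fun y : ℝ => y ^ (-(1 / 2) : ℝ)) volume 0 ρ :=
      intervalIntegral.intervalIntegrable_rpow' (by norm_num)
    rw [← ofReal_integral_eq_lintegral_ofReal]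
    · apply ENNReal.ofReal_le_ofReal
      rw [← intervalIntegral.integral_of_le hρ.le, intervalIntegral.integral_const_mul,
        integral_rpow (Or.inl (by norm_num))]
      norm_num
      rw [← Real.sqrt_eq_rpow]
      have : 0 < Real.sqrt ρ := by positivity
      apply le_of_eq
      field_simp
    · exact ((intervalIntegrable_iff_integrableOn_Ioc_of_le hρ.le).1 hi).const_mul _
    · filter_upwards [ae_restrict_mem measurableSet_Ioc] with y hy
      have : 0 < y := hy.1
      positivity
  rcases le_total Y ρ with h | h
  · refine (lintegral_mono_set (Set.Ioc_subset_Ioc_right h)).trans (h1.trans ?_)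
    apply ENNReal.ofReal_le_ofReal
    linarith [le_max_left 0 (Real.log (Y / ρ))]
  · have h2 : ∫⁻ y in Set.Ioc ρ Y, ENNReal.ofReal (1 / Real.sqrt (max ρ y) * y ^ (-(1 / 2) : ℝ)) ≤
        ENNReal.ofReal (Real.log (Y / ρ)) := by
      have e : ∀ y ∈ Set.Ioc ρ Y, ENNReal.ofReal (1 / Real.sqrt (max ρ y) * y ^ (-(1 / 2) : ℝ)) =
          ENNReal.ofReal y⁻¹ := by
        intro y hy
        have hy0 : 0 < y := hρ.trans hy.1
        rw [max_eq_right hy.1.le, rpow_neg_half hy0]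
        congr 1
        have := Real.mul_self_sqrt hy0.le
        rw [div_mul_div_comm, this]
        simp
      rw [setLIntegral_congr_fun measurableSet_Ioc e]
      have hi : IntervalIntegrable (fun y : ℝ => y⁻¹) volume ρ Y :=
        intervalIntegrable_inv_iff.2 (Or.inr (by
          rw [Set.uIcc_of_le h]; intro h; exact absurd h.1 (not_le.2 hρ)))
      rw [← ofReal_integral_eq_lintegral_ofReal]
      · rw [← intervalIntegral.integral_of_le h, integral_inv_of_pos hρ hY]
      · exact (intervalIntegrable_iff_integrableOn_Ioc_of_le h).1 hi
      · filter_upwards [ae_restrict_mem measurableSet_Ioc] with y hy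
        have : 0 < y := hρ.trans hy.1
        positivity
    rw [← Set.Ioc_union_Ioc_eq_Ioc hρ.le h,
      lintegral_union measurableSet_Ioc (Set.Ioc_disjoint_Ioc_of_le le_rfl)]
    have hlog : 0 ≤ Real.log (Y / ρ) := Real.log_nonneg ((one_le_div hρ).2 h)
    rw [max_eq_right hlog, ENNReal.ofReal_add (by norm_num) hlog]
    exact add_le_add h1 h2

/-- The majorant for the contribution of the fractions with denominators in
`[16^l N, 16^(l+1) N)`. -/
noncomputable def blockMajorant (N K : ℝ) (l : ℕ) (y : ℝ) : ENNReal :=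
  (Set.Ioc 0 (1 / (16 ^ l * N) ^ 2)).indicator (fun y => ENNReal.ofReal (10 / Real.sqrt (16 ^ l * N)) *
    ENNReal.ofReal (1 / Real.sqrt (max (excludedRadius N K l) y) * y ^ (-(1 / 2) : ℝ))) y

lemma measurable_blockMajorant (N K : ℝ) (l : ℕ) : Measurable (blockMajorant N K l) := by
  unfold blockMajorant
  refine Measurable.indicator ?_ measurableSet_Ioc
  fun_prop

lemma excludedRadius_pos {N K : ℝ} (hN : 0 < N) (l : ℕ) : 0 < excludedRadius N K l := by
  unfold excludedRadius; positivity

lemma lintegral_blockMajorant_le {N K : ℝ} (hN : 0 < N) (hK : 0 ≤ K) (l : ℕ) :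
    ∫⁻ y, blockMajorant N K l y ≤
      ENNReal.ofReal (10 / Real.sqrt N * (2 * (1 / 4) ^ l + K * (1 / 2) ^ l)) := by
  have hM : 0 < 16 ^ l * N := by positivity
  unfold blockMajorant
  rw [lintegral_indicator measurableSet_Ioc, lintegral_const_mul' _ _ ENNReal.ofReal_ne_top]
  have hlog : Real.log (1 / (16 ^ l * N) ^ 2 / excludedRadius N K l) = 2 ^ l * K := by
    rw [excludedRadius, div_div_div_cancel_right₀ (by positivity), one_div, ← Real.exp_neg, neg_neg,
      Real.log_exp]
  have h := lintegral_rpow_neg_half_max_le (excludedRadius_pos (K := K) hN l)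
    (show 0 < 1 / (16 ^ l * N) ^ 2 by positivity)
  rw [hlog, max_eq_right (by positivity)] at h
  calc _ ≤ ENNReal.ofReal (10 / Real.sqrt (16 ^ l * N)) * ENNReal.ofReal (2 + 2 ^ l * K) := by gcongr
    _ = _ := by
      rw [← ENNReal.ofReal_mul (by positivity)]
      congr 1
      have e : Real.sqrt (16 ^ l * N) = 4 ^ l * Real.sqrt N := by
        rw [Real.sqrt_mul (by positivity), show (16 : ℝ) ^ l = (4 ^ l) ^ 2 by
          rw [← pow_mul, mul_comm l 2, pow_mul]; norm_num, Real.sqrt_sq (by positivity)]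
      have hs : 0 < Real.sqrt N := by positivity
      have h4 : (4 : ℝ) ^ l = 2 ^ l * 2 ^ l := by rw [← mul_pow]; norm_num
      rw [e, one_div_pow, one_div_pow, h4]
      field_simp

lemma lintegral_tsum_blockMajorant_le {N K : ℝ} (hN : 0 < N) (hK : 0 ≤ K) :
    ∫⁻ y, ∑' l, blockMajorant N K l y ≤ ENNReal.ofReal (10 / Real.sqrt N * (3 + 2 * K)) := by
  rw [lintegral_tsum fun l => (measurable_blockMajorant N K l).aemeasurable]
  have h4 := (hasSum_geometric_of_lt_one (by norm_num) (by norm_num : (1 / 4 : ℝ) < 1)).mul_left 2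
  have h2 := (hasSum_geometric_of_lt_one (by norm_num) (by norm_num : (1 / 2 : ℝ) < 1)).mul_left K
  have hs := (h4.add h2).mul_left (10 / Real.sqrt N)
  calc _ ≤ ∑' l : ℕ, ENNReal.ofReal (10 / Real.sqrt N * (2 * (1 / 4) ^ l + K * (1 / 2) ^ l)) :=
        ENNReal.tsum_le_tsum fun l => lintegral_blockMajorant_le hN hK l
    _ = ENNReal.ofReal (∑' l : ℕ, 10 / Real.sqrt N * (2 * (1 / 4) ^ l + K * (1 / 2) ^ l)) :=
        (ENNReal.ofReal_tsum_of_nonneg (fun l => by positivity) hs.summable).symm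
    _ ≤ _ := by
        rw [hs.tsum_eq]
        apply ENNReal.ofReal_le_ofReal
        refine mul_le_mul_of_nonneg_left ?_ (by positivity)
        have e4 : (1 - 1 / 4 : ℝ)⁻¹ = 4 / 3 := by norm_num
        have e2 : (1 - 1 / 2 : ℝ)⁻¹ = 2 := by norm_num
        rw [e4, e2]
        linarith

lemma Rat.norm_squareTheta_le {r : ℚ} {x y : ℝ} (hy : 0 < y)
    (h1 : (r.den : ℝ) * |x - r| ≤ Real.sqrt y) (h2 : (r.den : ℝ) ^ 2 * y ≤ 1) :
    ‖squareTheta (x + y * Complex.I)‖ ≤ 10 / Real.sqrt (r.den * max |x - r| y) := by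
  have hr : (0 : ℝ) < r.den := by exact_mod_cast r.den_pos
  have h := norm_squareTheta_le_of_sq_le (x := x) r.den_pos r.isCoprime_num_den hy
  rw [← Rat.cast_def r] at h
  refine h ?_ h2
  rw [← sq_abs (x - r), ← mul_pow]
  calc _ ≤ Real.sqrt y ^ 2 := by gcongr
    _ = y := Real.sq_sqrt hy.le

lemma theta_le_tsum_blockMajorant {N K x y : ℝ} (hN : 0 < N)
    (hx : x ∉ wellApproxSet N K) (hy : 0 < y) {r : ℚ} (hr : N ≤ r.den)
    (h1 : (r.den : ℝ) * |x - r| ≤ Real.sqrt y) (h2 : (r.den : ℝ) ^ 2 * y ≤ 1) :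
    ‖squareTheta (x + y * Complex.I)‖ₑ * ENNReal.ofReal (y ^ (-(1 / 2) : ℝ)) ≤
      ∑' l, blockMajorant N K l y := by
  obtain ⟨l, hl1, hl2⟩ := exists_nat_pow_near ((one_le_div hN).2 hr) (by norm_num : (1 : ℝ) < 16)
  rw [le_div_iff₀ hN] at hl1
  rw [div_lt_iff₀ hN] at hl2
  have hM : 0 < 16 ^ l * N := by positivity
  have hρ : excludedRadius N K l ≤ |x - r| := by
    by_contra! hlt
    exact hx ⟨l, r, hl1, hl2, hlt⟩
  have hρ0 := excludedRadius_pos (K := K) hN l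
  refine le_trans ?_ (ENNReal.le_tsum l)
  have hyM : y ≤ 1 / (16 ^ l * N) ^ 2 := by
    rw [le_div_iff₀ (by positivity)]
    calc y * (16 ^ l * N) ^ 2 ≤ y * (r.den : ℝ) ^ 2 := by gcongr
      _ ≤ 1 := by linarith
  rw [blockMajorant, Set.indicator_of_mem (show y ∈ Set.Ioc 0 (1 / (16 ^ l * N) ^ 2) from ⟨hy, hyM⟩), ← ofReal_norm,
    ← ENNReal.ofReal_mul (norm_nonneg _), ← ENNReal.ofReal_mul (by positivity)]
  apply ENNReal.ofReal_le_ofReal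
  rw [← mul_assoc]
  gcongr
  calc _ ≤ 10 / Real.sqrt (r.den * max |x - r| y) := Rat.norm_squareTheta_le hy h1 h2
    _ ≤ 10 / Real.sqrt (16 ^ l * N * max (excludedRadius N K l) y) := by
        have : 0 < max (excludedRadius N K l) y := lt_max_of_lt_left hρ0
        gcongr
    _ = _ := by
        rw [Real.sqrt_mul hM.le]
        field_simp

/-- The theta mass at a point that avoids the neighbourhoods of all fractions. -/
lemma thetaMass_le_of_notMem {N K x Y : ℝ} (hN : 0 < N) (hK : 0 ≤ K) (hY : Y ≤ 1)
    (hx : x ∉ wellApproxSet N K)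
    (hfar : ∀ r : ℚ, (r.den : ℝ) < N → Real.sqrt Y < r.den * |x - r|) :
    thetaMass x (Set.Ioc 0 Y) ≤ ENNReal.ofReal (10 / Real.sqrt N * (3 + 2 * K)) := by
  refine le_trans ?_ (lintegral_tsum_blockMajorant_le hN hK)
  refine (setLIntegral_mono' measurableSet_Ioc ?_).trans (setLIntegral_le_lintegral _ _)
  rintro y ⟨hy0, hyY⟩
  obtain ⟨r, h2, h1⟩ := exists_rat_den_sq_mul_le x hy0 (hyY.trans hY)
  refine theta_le_tsum_blockMajorant hN hx hy0 ?_ h1 h2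
  by_contra! hlt
  exact absurd (hfar r hlt) (not_lt.2 (h1.trans (Real.sqrt_le_sqrt hyY)))

lemma lintegral_main_term_le {b h Y : ℝ} (hb : 0 < b) (hh : 0 < h) (hY : 0 < Y)
    (hbh : b ^ 2 * h ≤ 1) (hbY : b ^ 2 * Y ≤ 1) :
    ∫⁻ y in Set.Ioc 0 Y, ENNReal.ofReal (1 / Real.sqrt b * (1 / Real.sqrt (max h y) *
      y ^ (-(1 / 2) : ℝ)) + (Set.Ici (b ^ 2 * h ^ 2)).indicator (fun y =>
        9 * (b * Real.sqrt b) * (h * Real.sqrt h * y ^ (-(3 / 2) : ℝ) + 1)) y) ≤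
      ENNReal.ofReal (1 / Real.sqrt b * (29 + max 0 (Real.log (Y / h)))) := by
  have hsb : 0 < Real.sqrt b := by positivity
  have hbh0 : 0 < b ^ 2 * h ^ 2 := by positivity
  have hlog := le_max_left 0 (Real.log (Y / h))
  have h1 : ∫⁻ y in Set.Ioc 0 Y, ENNReal.ofReal (1 / Real.sqrt b * (1 / Real.sqrt (max h y) *
      y ^ (-(1 / 2) : ℝ))) ≤ ENNReal.ofReal (1 / Real.sqrt b * (2 + max 0 (Real.log (Y / h)))) := by
    simp_rw [ENNReal.ofReal_mul (by positivity : 0 ≤ 1 / Real.sqrt b)]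
    rw [lintegral_const_mul' _ _ ENNReal.ofReal_ne_top]
    gcongr
    exact lintegral_rpow_neg_half_max_le hh hY
  have hi : IntegrableOn (fun y : ℝ => y ^ (-(3 / 2) : ℝ)) (Set.Ioi (b ^ 2 * h ^ 2)) :=
    integrableOn_Ioi_rpow_of_lt (by norm_num) hbh0
  have h2 : ∫⁻ y in Set.Ioc 0 Y, (Set.Ici (b ^ 2 * h ^ 2)).indicator (fun y =>
      ENNReal.ofReal (9 * (b * Real.sqrt b) * (h * Real.sqrt h) * y ^ (-(3 / 2) : ℝ))) y ≤
      ENNReal.ofReal (18 / Real.sqrt b) := by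
    refine (setLIntegral_le_lintegral _ _).trans ?_
    rw [lintegral_indicator measurableSet_Ici, setLIntegral_congr Ioi_ae_eq_Ici.symm,
      ← ofReal_integral_eq_lintegral_ofReal (hi.const_mul _)]
    · apply ENNReal.ofReal_le_ofReal
      rw [integral_const_mul, integral_Ioi_rpow_of_lt (by norm_num) hbh0]
      have e : (b ^ 2 * h ^ 2) ^ ((-(3 / 2) : ℝ) + 1) = 1 / (b * h) := by
        rw [← mul_pow, ← Real.rpow_natCast, ← Real.rpow_mul (by positivity)]
        norm_num
        rw [Real.rpow_neg_one]
        field_simp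
      rw [e]
      norm_num
      have hb2 : b * Real.sqrt h ≤ 1 := by
        have : (b * Real.sqrt h) ^ 2 ≤ 1 := by rw [mul_pow, Real.sq_sqrt hh.le]; exact hbh
        exact (abs_le_one_iff_mul_self_le_one.2 (by nlinarith)).trans' (le_abs_self _)
      rw [le_div_iff₀ hsb]
      have hs := Real.mul_self_sqrt hb.le
      calc _ = 18 * (Real.sqrt b * Real.sqrt b) * Real.sqrt h := by field_simp; ring
        _ = 18 * (b * Real.sqrt h) := by rw [hs]; ring
        _ ≤ 18 := by linarith
    · filter_upwards [ae_restrict_mem measurableSet_Ioi] with y hy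
      have : 0 < y := hbh0.trans hy
      positivity
  have h3 : ∫⁻ _ in Set.Ioc 0 Y, ENNReal.ofReal (9 * (b * Real.sqrt b)) ≤
      ENNReal.ofReal (9 / Real.sqrt b) := by
    rw [setLIntegral_const, Real.volume_Ioc, sub_zero, ← ENNReal.ofReal_mul (by positivity)]
    apply ENNReal.ofReal_le_ofReal
    rw [le_div_iff₀ hsb]
    have hs := Real.mul_self_sqrt hb.le
    calc _ = 9 * (b * (Real.sqrt b * Real.sqrt b) * Y) := by ring
      _ = 9 * (b ^ 2 * Y) := by rw [hs]; ring
      _ ≤ 9 := by linarith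
  calc _ ≤ ∫⁻ y in Set.Ioc 0 Y, (ENNReal.ofReal (1 / Real.sqrt b * (1 / Real.sqrt (max h y) *
        y ^ (-(1 / 2) : ℝ))) + ((Set.Ici (b ^ 2 * h ^ 2)).indicator (fun y =>
        ENNReal.ofReal (9 * (b * Real.sqrt b) * (h * Real.sqrt h) * y ^ (-(3 / 2) : ℝ))) y +
        ENNReal.ofReal (9 * (b * Real.sqrt b)))) := by
        refine lintegral_mono fun y => ?_
        refine ENNReal.ofReal_add_le.trans ?_
        gcongr
        by_cases hy : y ∈ Set.Ici (b ^ 2 * h ^ 2)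
        · rw [Set.indicator_of_mem hy, Set.indicator_of_mem hy]
          refine le_trans (le_of_eq ?_) ENNReal.ofReal_add_le
          congr 1
          ring
        · rw [Set.indicator_of_notMem hy, Set.indicator_of_notMem hy, ENNReal.ofReal_zero]
          exact zero_le
    _ ≤ ENNReal.ofReal (1 / Real.sqrt b * (2 + max 0 (Real.log (Y / h)))) +
        (ENNReal.ofReal (18 / Real.sqrt b) + ENNReal.ofReal (9 / Real.sqrt b)) := by
        rw [lintegral_add_left (by fun_prop), lintegral_add_right _ measurable_const]
        gcongr
    _ = _ := by
        rw [← ENNReal.ofReal_add (by positivity) (by positivity),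
          ← ENNReal.ofReal_add (by positivity) (by positivity)]
        congr 1
        ring

/-- The theta mass at a point near one fraction that avoids the neighbourhoods of the others. -/
lemma thetaMass_le_of_near {N N' K x Y : ℝ} (hK : 0 ≤ K) (hY0 : 0 < Y)
    (hY : Y ≤ 1) (hYN : N * Real.sqrt Y ≤ 1 / 2) {s : ℚ} (hs : (s.den : ℝ) < N)
    (hxs : (s.den : ℝ) * |x - s| ≤ Real.sqrt Y) (hne : x ≠ s) (hN' : 0 < N')
    (hN's : N' * (2 * s.den * |x - s|) ≤ 1) (hx : x ∉ wellApproxSet N' K) :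
    thetaMass x (Set.Ioc 0 Y) ≤
      ENNReal.ofReal (1 / Real.sqrt s.den * (29 + max 0 (Real.log (Y / |x - s|)))) +
      ENNReal.ofReal (10 / Real.sqrt N' * (3 + 2 * K)) := by
  have hs0 : (0 : ℝ) < s.den := by exact_mod_cast s.den_pos
  have hh : 0 < |x - s| := abs_pos.2 (sub_ne_zero.2 hne)
  have hsY : 0 < Real.sqrt Y := by positivity
  have hbY : (s.den : ℝ) * Real.sqrt Y ≤ 1 / 2 := by nlinarith
  refine le_trans ?_ (add_le_add (lintegral_main_term_le hs0 hh hY0 ?_ ?_)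
    (lintegral_tsum_blockMajorant_le hN' hK))
  · refine le_trans ?_ (add_le_add le_rfl (setLIntegral_le_lintegral (Set.Ioc 0 Y) _))
    rw [← lintegral_add_right _
      (Measurable.tsum fun l => measurable_blockMajorant N' K l)]
    refine setLIntegral_mono' measurableSet_Ioc ?_
    rintro y ⟨hy0, hyY⟩
    obtain ⟨r, h2, h1⟩ := exists_rat_den_sq_mul_le x hy0 (hyY.trans hY)
    by_cases hrs : r = s
    · subst hrs
      refine le_trans ?_ le_self_add
      have hsy : 0 < Real.sqrt y := by positivity
      have hmem : y ∈ Set.Ici ((r.den : ℝ) ^ 2 * |x - r| ^ 2) := by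
        rw [Set.mem_Ici, ← mul_pow]
        calc _ ≤ Real.sqrt y ^ 2 := by gcongr
          _ = y := Real.sq_sqrt hy0.le
      rw [Set.indicator_of_mem hmem, ← ofReal_norm, ← ENNReal.ofReal_mul (norm_nonneg _)]
      apply ENNReal.ofReal_le_ofReal
      have h := norm_squareTheta_le_main (x := x) r.den_pos r.isCoprime_num_den hy0
      rw [← Rat.cast_def r] at h
      set m := max |x - r| y with hm
      have hm0 : 0 < m := lt_max_of_lt_left hh
      have hmm : m * Real.sqrt m ≤ |x - r| * Real.sqrt |x - r| + y * Real.sqrt y := by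
        rcases max_choice |x - r| y with h' | h'
        · rw [hm, h']; linarith [mul_pos hy0 hsy]
        · rw [hm, h']; linarith [mul_pos hh (Real.sqrt_pos.2 hh)]
      have e2 : y ^ (-(3 / 2) : ℝ) = 1 / (y * Real.sqrt y) := by
        rw [show (-(3 / 2) : ℝ) = -1 + -(1 / 2) by norm_num, Real.rpow_add hy0, rpow_neg_half hy0,
          Real.rpow_neg_one]
        field_simp
      rw [e2, rpow_neg_half hy0]
      calc _ ≤ (1 / Real.sqrt (r.den * m) +
            9 * ((r.den * m) * Real.sqrt (r.den * m)) / y) * (1 / Real.sqrt y) := by gcongr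
        _ = 1 / Real.sqrt r.den * (1 / Real.sqrt m * (1 / Real.sqrt y)) +
            9 * (r.den * Real.sqrt r.den) * ((m * Real.sqrt m) / (y * Real.sqrt y)) := by
            rw [Real.sqrt_mul hs0.le]
            have : 0 < Real.sqrt m := by positivity
            field_simp
        _ ≤ 1 / Real.sqrt r.den * (1 / Real.sqrt m * (1 / Real.sqrt y)) +
            9 * (r.den * Real.sqrt r.den) *
              ((|x - r| * Real.sqrt |x - r| + y * Real.sqrt y) / (y * Real.sqrt y)) := by gcongr
        _ = _ := by
            field_simp
    · refine le_trans ?_ le_add_self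
      refine theta_le_tsum_blockMajorant hN' hx hy0 ?_ h1 h2
      have hr0 : (0 : ℝ) < r.den := by exact_mod_cast r.den_pos
      have hsep := Rat.one_le_abs_sub_mul_den hrs
      have htri : |(r : ℝ) - s| ≤ |x - r| + |x - s| := by
        rw [show (r : ℝ) - s = (x - s) - (x - r) by ring]
        exact (abs_sub _ _).trans (by linarith)
      have h3 : (1 : ℝ) ≤ (r.den * |x - r|) * s.den + r.den * (s.den * |x - s|) := by
        calc (1 : ℝ) ≤ (|x - r| + |x - s|) * (r.den * s.den) := hsep.trans (by gcongr)
          _ = _ := by ring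
      have h4 : (r.den * |x - r|) * s.den ≤ 1 / 2 := by
        calc (r.den * |x - r|) * s.den ≤ Real.sqrt Y * s.den := by
              gcongr
              exact h1.trans (Real.sqrt_le_sqrt hyY)
          _ ≤ 1 / 2 := by linarith
      have h5 : 1 ≤ r.den * (2 * s.den * |x - s|) := by linarith
      have h6 : N' * (2 * s.den * |x - s|) ≤ r.den * (2 * s.den * |x - s|) := hN's.trans h5
      exact le_of_mul_le_mul_right h6 (by positivity)
  · have : (s.den : ℝ) ^ 2 * |x - s| = s.den * (s.den * |x - s|) := by ring
    rw [this]
    nlinarith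
  · calc (s.den : ℝ) ^ 2 * Y = (s.den * Real.sqrt Y) ^ 2 := by rw [mul_pow, Real.sq_sqrt hY0.le]
      _ ≤ (1 / 2) ^ 2 := by gcongr
      _ ≤ 1 := by norm_num

/-! ### The measure of the exceptional sets -/

lemma Rat.eq_of_floor_eq {B : ℝ} {r s : ℚ} (hr : (r.den : ℝ) < B) (hs : (s.den : ℝ) < B)
    (h : ⌊B ^ 2 * (r : ℝ)⌋ = ⌊B ^ 2 * (s : ℝ)⌋) : r = s := by
  by_contra hne
  have h1 := Rat.one_le_abs_sub_mul_den hne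
  have h2 := Int.abs_sub_lt_one_of_floor_eq_floor h
  have hr0 : (0 : ℝ) < r.den := by exact_mod_cast r.den_pos
  have hs0 : (0 : ℝ) < s.den := by exact_mod_cast s.den_pos
  have hB : 0 < B := hr0.trans hr
  rw [← mul_sub, abs_mul, abs_of_pos (by positivity)] at h2
  have h3 : |(r : ℝ) - s| * (r.den * s.den) ≤ |(r : ℝ) - s| * (B * B) := by gcongr
  nlinarith

/-- A union bound over the fractions with bounded denominators in an interval. -/
lemma measure_rat_le {B u v : ℝ} (huv : u ≤ v) (f : ℚ → Set ℝ) {c : ENNReal}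
    (hf : ∀ r, volume (f r) ≤ c) :
    volume {x : ℝ | ∃ r : ℚ, (r.den : ℝ) < B ∧ u ≤ r ∧ r ≤ v ∧ x ∈ f r} ≤
      ENNReal.ofReal (B ^ 2 * (v - u) + 2) * c := by
  set S := Finset.Icc ⌊B ^ 2 * u⌋ ⌊B ^ 2 * v⌋ with hS
  have hsub : {x : ℝ | ∃ r : ℚ, (r.den : ℝ) < B ∧ u ≤ r ∧ r ≤ v ∧ x ∈ f r} ⊆
      ⋃ k ∈ S, {x : ℝ | ∃ r : ℚ, (r.den : ℝ) < B ∧ ⌊B ^ 2 * (r : ℝ)⌋ = k ∧ x ∈ f r} := by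
    rintro x ⟨r, h1, h2, h3, h4⟩
    simp only [Set.mem_iUnion]
    refine ⟨⌊B ^ 2 * (r : ℝ)⌋, ?_, r, h1, rfl, h4⟩
    rw [hS, Finset.mem_Icc]
    constructor <;> apply Int.floor_le_floor <;> gcongr
  have hk : ∀ k ∈ S, volume {x : ℝ | ∃ r : ℚ, (r.den : ℝ) < B ∧ ⌊B ^ 2 * (r : ℝ)⌋ = k ∧ x ∈ f r} ≤ c := by
    intro k _
    by_cases hex : ∃ r : ℚ, (r.den : ℝ) < B ∧ ⌊B ^ 2 * (r : ℝ)⌋ = k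
    · obtain ⟨r, hr, hrk⟩ := hex
      refine (measure_mono ?_).trans (hf r)
      rintro x ⟨s, hs, hsk, hx⟩
      rwa [Rat.eq_of_floor_eq hr hs (hrk.trans hsk.symm)]
    · have : {x : ℝ | ∃ r : ℚ, (r.den : ℝ) < B ∧ ⌊B ^ 2 * (r : ℝ)⌋ = k ∧ x ∈ f r} = ∅ := by
        ext x
        simp only [Set.mem_ofPred_eq, Set.mem_empty_iff_false, iff_false]
        rintro ⟨s, hs, hsk, _⟩
        exact hex ⟨s, hs, hsk⟩
      rw [this, measure_empty]
      exact zero_le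
  calc _ ≤ ∑ k ∈ S, volume {x : ℝ | ∃ r : ℚ, (r.den : ℝ) < B ∧ ⌊B ^ 2 * (r : ℝ)⌋ = k ∧ x ∈ f r} :=
        (measure_mono hsub).trans (measure_biUnion_finset_le _ _)
    _ ≤ ∑ _k ∈ S, c := Finset.sum_le_sum hk
    _ = (S.card : ENNReal) * c := by rw [Finset.sum_const, nsmul_eq_mul]
    _ ≤ _ := by
        gcongr
        rw [← ENNReal.ofReal_natCast]
        apply ENNReal.ofReal_le_ofReal
        rw [hS, Int.card_Icc]
        have h1 := Int.lt_floor_add_one (B ^ 2 * u)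
        have h2 := Int.floor_le (B ^ 2 * v)
        have h3 : ⌊B ^ 2 * u⌋ ≤ ⌊B ^ 2 * v⌋ := Int.floor_le_floor (by gcongr)
        have h4 : (((⌊B ^ 2 * v⌋ + 1 - ⌊B ^ 2 * u⌋).toNat : ℤ) : ℝ) =
            ⌊B ^ 2 * v⌋ + 1 - ⌊B ^ 2 * u⌋ := by
          rw [Int.toNat_of_nonneg (by omega)]
          push_cast
          ring
        rw [Int.cast_natCast] at h4
        rw [h4]
        linarith

lemma volume_block_le {M ρ u v : ℝ} (hρ : 0 ≤ ρ) (hρM : ρ * M ^ 2 ≤ 1) (huv : u ≤ v)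
    (hMuv : 1 ≤ M ^ 2 * (v - u)) :
    volume ({x : ℝ | ∃ r : ℚ, (r.den : ℝ) < 16 * M ∧ |x - r| < ρ} ∩ Set.Icc u v) ≤
      ENNReal.ofReal (1540 * (M ^ 2 * (v - u)) * ρ) := by
  have hsub : {x : ℝ | ∃ r : ℚ, (r.den : ℝ) < 16 * M ∧ |x - r| < ρ} ∩ Set.Icc u v ⊆
      {x : ℝ | ∃ r : ℚ, (r.den : ℝ) < 16 * M ∧ u - ρ ≤ r ∧ r ≤ v + ρ ∧
        x ∈ Set.Ioo ((r : ℝ) - ρ) (r + ρ)} := by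
    rintro x ⟨⟨r, h1, h2⟩, h3, h4⟩
    rw [abs_lt] at h2
    exact ⟨r, h1, by linarith, by linarith, by linarith, by linarith⟩
  refine (measure_mono hsub).trans ((measure_rat_le (by linarith) (fun r : ℚ => Set.Ioo ((r : ℝ) - ρ) (r + ρ)) (c := ENNReal.ofReal (2 * ρ))
    fun r => ?_).trans ?_)
  · rw [Real.volume_Ioo]
    apply ENNReal.ofReal_le_ofReal
    linarith
  · rw [← ENNReal.ofReal_mul (by nlinarith)]
    apply ENNReal.ofReal_le_ofReal
    have : (16 * M) ^ 2 * (v + ρ - (u - ρ)) + 2 ≤ 770 * (M ^ 2 * (v - u)) := by nlinarith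
    nlinarith

lemma tsum_exp_neg_two_pow_le {K : ℝ} (hK : 1 ≤ K) :
    ∑' l : ℕ, ENNReal.ofReal (Real.exp (-(2 ^ l * K))) ≤ ENNReal.ofReal (2 * Real.exp (-K)) := by
  have hg := (hasSum_geometric_of_lt_one (by norm_num) (by norm_num : (1 / 2 : ℝ) < 1)).mul_left
    (Real.exp (-K))
  have he : Real.exp (-1) ≤ 1 / 2 := by
    rw [Real.exp_neg, one_div]
    apply inv_anti₀ (by norm_num)
    linarith [Real.add_one_le_exp (1 : ℝ)]
  calc _ ≤ ∑' l : ℕ, ENNReal.ofReal (Real.exp (-K) * (1 / 2) ^ l) := by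
        refine ENNReal.tsum_le_tsum fun l => ENNReal.ofReal_le_ofReal ?_
        calc Real.exp (-(2 ^ l * K)) ≤ Real.exp (-K + l * (-1)) := by
              apply Real.exp_le_exp.2
              have h1 : (l : ℝ) + 1 ≤ 2 ^ l := by exact_mod_cast Nat.lt_two_pow_self
              nlinarith
          _ = Real.exp (-K) * Real.exp (-1) ^ l := by rw [Real.exp_add, Real.exp_nat_mul]
          _ ≤ _ := by gcongr
    _ = ENNReal.ofReal (∑' l : ℕ, Real.exp (-K) * (1 / 2) ^ l) :=
        (ENNReal.ofReal_tsum_of_nonneg (fun l => by positivity) hg.summable).symm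
    _ ≤ _ := by
        rw [hg.tsum_eq]
        apply ENNReal.ofReal_le_ofReal
        apply le_of_eq
        norm_num
        ring

/-- The measure of the set of points close to a fraction with a large denominator. -/
lemma volume_wellApproxSet_le {N K u v : ℝ} (hN : 0 < N) (huv : u ≤ v)
    (hNuv : 1 ≤ N ^ 2 * (v - u)) :
    volume (wellApproxSet N K ∩ Set.Icc u v) ≤ ENNReal.ofReal (3080 * (v - u) * Real.exp (-K)) := by
  have hvu : 0 ≤ v - u := by linarith
  rcases le_total 1 K with hK | hK
  · have hsub : wellApproxSet N K ∩ Set.Icc u v ⊆ ⋃ l : ℕ,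
        ({x : ℝ | ∃ r : ℚ, (r.den : ℝ) < 16 * (16 ^ l * N) ∧ |x - r| < excludedRadius N K l} ∩
          Set.Icc u v) := by
      rintro x ⟨⟨l, r, _, h2, h3⟩, h4⟩
      rw [Set.mem_iUnion]
      refine ⟨l, ⟨r, ?_, h3⟩, h4⟩
      rw [← mul_assoc, ← pow_succ']
      exact h2
    have hl : ∀ l : ℕ, volume ({x : ℝ | ∃ r : ℚ, (r.den : ℝ) < 16 * (16 ^ l * N) ∧
        |x - r| < excludedRadius N K l} ∩ Set.Icc u v) ≤
        ENNReal.ofReal (1540 * (v - u)) * ENNReal.ofReal (Real.exp (-(2 ^ l * K))) := by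
      intro l
      have hM : 0 < 16 ^ l * N := by positivity
      have h1 : (1 : ℝ) ≤ 16 ^ l := one_le_pow₀ (by norm_num)
      have hNM : N ≤ 16 ^ l * N := by nlinarith
      have hexp : Real.exp (-(2 ^ l * K)) ≤ 1 := Real.exp_le_one_iff.2 (by
        have : 0 ≤ 2 ^ l * K := by positivity
        linarith)
      have e : excludedRadius N K l * (16 ^ l * N) ^ 2 = Real.exp (-(2 ^ l * K)) := by
        unfold excludedRadius; field_simp
      refine (volume_block_le (excludedRadius_pos hN l).le (by rw [e]; exact hexp) huv ?_).trans
        (le_of_eq ?_)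
      · exact hNuv.trans (by gcongr)
      · rw [← ENNReal.ofReal_mul (by positivity), ← e]
        congr 1
        ring
    calc _ ≤ ∑' l : ℕ, ENNReal.ofReal (1540 * (v - u)) * ENNReal.ofReal (Real.exp (-(2 ^ l * K))) :=
          ((measure_mono hsub).trans (measure_iUnion_le _)).trans (ENNReal.tsum_le_tsum hl)
      _ ≤ ENNReal.ofReal (1540 * (v - u)) * ENNReal.ofReal (2 * Real.exp (-K)) := by
          rw [ENNReal.tsum_mul_left]
          gcongr
          exact tsum_exp_neg_two_pow_le hK
      _ = _ := by
          rw [← ENNReal.ofReal_mul (by positivity)]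
          congr 1
          ring
  · refine (measure_mono Set.inter_subset_right).trans ?_
    rw [Real.volume_Icc]
    apply ENNReal.ofReal_le_ofReal
    have h1 : Real.exp (-1) ≤ Real.exp (-K) := Real.exp_le_exp.2 (by linarith)
    have h2 : (1 / 3 : ℝ) ≤ Real.exp (-1) := by
      rw [Real.exp_neg, one_div]
      exact inv_anti₀ (Real.exp_pos _) (by linarith [Real.exp_one_lt_d9])
    nlinarith

/-- The constant relating the length of the interval to the denominators considered. -/
noncomputable def thresholdConst : ℝ := 2400

lemma exists_nat_two_pow_near_exp {t : ℝ} (ht : 0 ≤ t) :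
    ∃ n : ℕ, (2 : ℝ) ^ n ≤ Real.exp t ∧ Real.exp t < 2 ^ (n + 1) :=
  exists_nat_pow_near (Real.one_le_exp ht) (by norm_num)

/-- The denominators considered in the `l`-th shell around a fraction. -/
noncomputable def shellThreshold (N : ℝ) (l : ℕ) : ℝ := N * max 1 (2 ^ l / (2 * thresholdConst ^ 2))

/-- The exceptional set near the fraction `s`. -/
noncomputable def shellSet (N L t : ℝ) (n : ℕ) (s : ℝ) : Set ℝ :=
  (⋃ l ∈ Finset.range n, wellApproxSet (shellThreshold N l) (2 * (t - (l + 1) * Real.log 2)) ∩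
    Set.Icc (s - L / 2 ^ l) (s + L / 2 ^ l)) ∪ Set.Icc (s - L / 2 ^ n) (s + L / 2 ^ n)

lemma volume_shellSet_le {N L t s : ℝ} {n : ℕ} (hL : 0 < L) (hN : 0 < N)
    (hNL : N ^ 2 * L = thresholdConst ^ 2) (h1 : (2 : ℝ) ^ n ≤ Real.exp t)
    (h2 : Real.exp t < 2 ^ (n + 1)) :
    volume (shellSet N L t n s) ≤ ENNReal.ofReal (30000 * L * Real.exp (-t)) := by
  have hA : 0 < thresholdConst := by unfold thresholdConst; norm_num
  have hl : ∀ l ∈ Finset.range n,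
      volume (wellApproxSet (shellThreshold N l) (2 * (t - (l + 1) * Real.log 2)) ∩
        Set.Icc (s - L / 2 ^ l) (s + L / 2 ^ l)) ≤
      ENNReal.ofReal (24640 * L * Real.exp (-t) ^ 2 * 2 ^ l) := by
    intro l _
    have hp : (0 : ℝ) < 2 ^ l := by positivity
    have hpos : 0 < L / 2 ^ l := by positivity
    have hthr : 0 < shellThreshold N l := mul_pos hN (lt_max_of_lt_left one_pos)
    refine (volume_wellApproxSet_le hthr (by linarith) ?_).trans (le_of_eq ?_)
    · have e : shellThreshold N l ^ 2 * (s + L / 2 ^ l - (s - L / 2 ^ l)) =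
          2 * (thresholdConst ^ 2 * max 1 (2 ^ l / (2 * thresholdConst ^ 2)) ^ 2) / 2 ^ l := by
        rw [shellThreshold, ← hNL]
        ring
      rw [e, le_div_iff₀ hp, one_mul]
      rcases le_total ((2 : ℝ) ^ l) (2 * thresholdConst ^ 2) with h | h
      · have : (1 : ℝ) ≤ max 1 (2 ^ l / (2 * thresholdConst ^ 2)) ^ 2 :=
          one_le_pow₀ (le_max_left _ _)
        nlinarith [sq_nonneg thresholdConst]
      · calc (2 : ℝ) ^ l ≤ 2 * (thresholdConst ^ 2 * (2 ^ l / (2 * thresholdConst ^ 2)) ^ 2) := by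
              have : 2 * (thresholdConst ^ 2 * (2 ^ l / (2 * thresholdConst ^ 2)) ^ 2) =
                (2 : ℝ) ^ l * (2 ^ l / (2 * thresholdConst ^ 2)) := by field_simp
              rw [this]
              have : (1 : ℝ) ≤ 2 ^ l / (2 * thresholdConst ^ 2) :=
                (one_le_div (by positivity)).2 h
              nlinarith
          _ ≤ _ := by gcongr; exact le_max_right _ _
    · congr 1
      have e : Real.exp (-(2 * (t - (l + 1) * Real.log 2))) =
          Real.exp (-t) ^ 2 * (4 * (2 ^ l * 2 ^ l)) := by
        rw [show -(2 * (t - (l + 1) * Real.log 2)) = 2 * (-t) + ((2 * (l + 1) : ℕ) : ℝ) * Real.log 2 by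
          push_cast; ring, Real.exp_add, Real.exp_nat_mul, Real.exp_log (by norm_num),
          show 2 * (-t) = ((2 : ℕ) : ℝ) * (-t) by push_cast; ring, Real.exp_nat_mul]
        rw [mul_add, pow_add, mul_comm 2 l, pow_mul]
        ring
      rw [e]
      field_simp
      ring
  have hsum : ∑ l ∈ Finset.range n, (2 : ℝ) ^ l ≤ 2 ^ n := by
    rw [geom_sum_eq (by norm_num)]
    norm_num
  have hexp : Real.exp (-t) * Real.exp t = 1 := by rw [← Real.exp_add]; simp
  have he := Real.exp_pos (-t)
  calc _ ≤ ∑ l ∈ Finset.range n, ENNReal.ofReal (24640 * L * Real.exp (-t) ^ 2 * 2 ^ l) +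
        ENNReal.ofReal (4 * L * Real.exp (-t)) := by
        refine (measure_union_le _ _).trans (add_le_add ?_ ?_)
        · exact (measure_biUnion_finset_le _ _).trans (Finset.sum_le_sum hl)
        · rw [Real.volume_Icc]
          apply ENNReal.ofReal_le_ofReal
          have hp : (0 : ℝ) < 2 ^ n := by positivity
          have : 1 / (2 : ℝ) ^ n ≤ 2 * Real.exp (-t) := by
            rw [div_le_iff₀ hp]
            rw [pow_succ] at h2
            nlinarith
          have e : s + L / 2 ^ n - (s - L / 2 ^ n) = 2 * L * (1 / 2 ^ n) := by ring
          rw [e]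
          nlinarith
    _ = ENNReal.ofReal (24640 * L * Real.exp (-t) ^ 2 * (∑ l ∈ Finset.range n, 2 ^ l) +
          4 * L * Real.exp (-t)) := by
        rw [← ENNReal.ofReal_sum_of_nonneg (fun l _ => by positivity), ← Finset.mul_sum,
          ENNReal.ofReal_add (by positivity) (by positivity)]
    _ ≤ _ := by
        apply ENNReal.ofReal_le_ofReal
        have h3 : Real.exp (-t) ^ 2 * ∑ l ∈ Finset.range n, (2 : ℝ) ^ l ≤ Real.exp (-t) := by
          calc _ ≤ Real.exp (-t) ^ 2 * Real.exp t := by gcongr; exact hsum.trans h1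
            _ = Real.exp (-t) * (Real.exp (-t) * Real.exp t) := by ring
            _ = _ := by rw [hexp, mul_one]
        nlinarith

/-! ### The level sets -/

/-- The exceptional set in the interval `[u, v]` of length `L`. -/
noncomputable def exceptionalSet (N L t : ℝ) (n : ℕ) (u v : ℝ) : Set ℝ :=
  (wellApproxSet N (2 * t) ∩ Set.Icc u v) ∪
    {x : ℝ | ∃ s : ℚ, (s.den : ℝ) < N ∧ u - L ≤ s ∧ s ≤ v + L ∧ x ∈ shellSet N L t n s}

lemma thresholdConst_pos : 0 < thresholdConst := by unfold thresholdConst; norm_num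

lemma volume_exceptionalSet_le : ∃ C : ℝ, 0 < C ∧ ∀ (N L t u v : ℝ) (n : ℕ), 0 < L → 0 < N →
    N ^ 2 * L = thresholdConst ^ 2 → v - u = L → 0 ≤ t → (2 : ℝ) ^ n ≤ Real.exp t →
    Real.exp t < 2 ^ (n + 1) →
    volume (exceptionalSet N L t n u v) ≤ ENNReal.ofReal (C * L * Real.exp (-t)) := by
  have hA := thresholdConst_pos
  refine ⟨3080 + (3 * thresholdConst ^ 2 + 2) * 30000, by positivity, ?_⟩
  intro N L t u v n hL hN hNL huv ht h1 h2
  have hA1 : 1 ≤ thresholdConst := by unfold thresholdConst; norm_num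
  have hfirst : volume (wellApproxSet N (2 * t) ∩ Set.Icc u v) ≤
      ENNReal.ofReal (3080 * L * Real.exp (-t)) := by
    refine (volume_wellApproxSet_le hN (by linarith) ?_).trans ?_
    · rw [huv, hNL]; exact one_le_pow₀ hA1
    · rw [huv]
      apply ENNReal.ofReal_le_ofReal
      gcongr
      linarith
  have hsecond := measure_rat_le (B := N) (u := u - L) (v := v + L) (by linarith)
    (fun s : ℚ => shellSet N L t n s) (fun s => volume_shellSet_le (s := s) hL hN hNL h1 h2)
  refine (measure_union_le _ _).trans ((add_le_add hfirst hsecond).trans (le_of_eq ?_))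
  have e : N ^ 2 * (v + L - (u - L)) + 2 = 3 * thresholdConst ^ 2 + 2 := by
    rw [← hNL, ← huv]; ring
  rw [e, ← ENNReal.ofReal_mul (by positivity), ← ENNReal.ofReal_add (by positivity) (by positivity)]
  congr 1
  ring

lemma ten_div_sqrt_le {N N' q : ℝ} (hq : 0 < q) (hN : 1600 * q ≤ N) (hN' : N ≤ N') :
    10 / Real.sqrt N' ≤ 1 / 4 * (1 / Real.sqrt q) := by
  have h : Real.sqrt (1600 * q) = 40 * Real.sqrt q := by
    rw [Real.sqrt_mul (by norm_num), show (1600 : ℝ) = 40 ^ 2 by norm_num, Real.sqrt_sq (by norm_num)]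
  have hs : 0 < Real.sqrt q := by positivity
  calc 10 / Real.sqrt N' ≤ 10 / Real.sqrt (1600 * q) := by gcongr; linarith
    _ = _ := by rw [h]; field_simp; norm_num

/-- Off the exceptional set the theta mass is small. -/
lemma thetaMass_le_of_notMem_exceptionalSet {N L t u v x : ℝ} {n : ℕ} {p q : ℕ} (hq : 0 < q)
    (hL : 0 < L) (hL1 : L ≤ 2) (hN : 0 < N) (hNL : N ^ 2 * L = thresholdConst ^ 2)
    (hNq : 1600 * (q : ℝ) ≤ N) (ht : 0 ≤ t) (h1 : (2 : ℝ) ^ n ≤ Real.exp t)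
    (hxI : x ∈ Set.Icc u v) (hirr : Irrational x) (hgood : IsGoodApprox p q x)
    (hx : x ∉ exceptionalSet N L t n u v) :
    thetaMass x (Set.Ioc 0 (L / (4 * thresholdConst ^ 2))) ≤
      ENNReal.ofReal ((t + 30) / Real.sqrt q) := by
  have hA := thresholdConst_pos
  have hA1 : 1 ≤ thresholdConst := by unfold thresholdConst; norm_num
  have hq0 : (0 : ℝ) < q := by exact_mod_cast hq
  have hsq : 0 < Real.sqrt q := by positivity
  set Y := L / (4 * thresholdConst ^ 2) with hYdef
  have hY0 : 0 < Y := by positivity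
  have hYN : Y = (1 / (2 * N)) ^ 2 := by
    rw [hYdef, ← hNL]; field_simp; norm_num
  have hsY : Real.sqrt Y = 1 / (2 * N) := by rw [hYN, Real.sqrt_sq (by positivity)]
  have hYL : Y ≤ L := by
    rw [hYdef]
    apply div_le_self hL.le
    nlinarith
  have hY1 : Y ≤ 1 := by
    rw [hYdef, div_le_one (by positivity)]
    nlinarith
  have hx1 : x ∉ wellApproxSet N (2 * t) := fun h => hx (Or.inl ⟨h, hxI⟩)
  have hlog2 : 0 < Real.log 2 := Real.log_pos (by norm_num)
  by_cases hfar : ∀ r : ℚ, (r.den : ℝ) < N → Real.sqrt Y < r.den * |x - r|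
  · refine (thetaMass_le_of_notMem hN (by linarith) hY1 hx1 hfar).trans ?_
    apply ENNReal.ofReal_le_ofReal
    calc _ ≤ 1 / 4 * (1 / Real.sqrt q) * (3 + 2 * (2 * t)) := by
          gcongr; exact ten_div_sqrt_le hq0 hNq le_rfl
      _ = (t + 3 / 4) / Real.sqrt q := by ring
      _ ≤ _ := by gcongr; norm_num
  · push Not at hfar
    obtain ⟨s, hsN, hxs⟩ := hfar
    have hs0 : (0 : ℝ) < s.den := by exact_mod_cast s.den_pos
    have hne : x ≠ s := fun h => hirr ⟨s, h.symm⟩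
    have hh : 0 < |x - s| := abs_pos.2 (sub_ne_zero.2 hne)
    have hqs : (q : ℝ) ≤ s.den := by
      by_contra! hlt
      have h := hgood.2 s.num s.den (by exact_mod_cast s.den_pos) (by exact_mod_cast hlt)
      have e : ((s.den : ℤ) : ℝ) * x - s.num = s.den * (x - s) := by
        rw [mul_sub]
        congr 1
        rw [Rat.cast_def s]
        field_simp
      rw [e, abs_mul, abs_of_pos hs0] at h
      have h3 : 1 / (2 * N) < 1 / (2 * (q : ℝ)) := by gcongr; linarith
      linarith [hxs.trans_eq hsY]
    have hNY : N * Real.sqrt Y ≤ 1 / 2 := by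
      rw [hsY]; apply le_of_eq; field_simp
    have hsqs : 1 / Real.sqrt s.den ≤ 1 / Real.sqrt q := by gcongr
    have hclose : N * (2 * s.den * |x - s|) ≤ 1 := by
      rw [hsY] at hxs
      calc N * (2 * s.den * |x - s|) = 2 * N * (s.den * |x - s|) := by ring
        _ ≤ 2 * N * (1 / (2 * N)) := by gcongr
        _ = 1 := by field_simp
    rcases lt_or_ge L |x - s| with hfarL | hnear
    · refine (thetaMass_le_of_near (N' := N) (K := 2 * t) (by linarith) hY0 hY1 hNY hsN hxs hne hN
        hclose hx1).trans ?_
      rw [← ENNReal.ofReal_add (by positivity) (by positivity)]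
      apply ENNReal.ofReal_le_ofReal
      have hlog : Real.log (Y / |x - s|) ≤ 0 :=
        Real.log_nonpos (by positivity) ((div_le_one hh).2 (by linarith))
      rw [max_eq_left hlog]
      calc _ ≤ 1 / Real.sqrt q * (29 + 0) + 1 / 4 * (1 / Real.sqrt q) * (3 + 2 * (2 * t)) := by
            gcongr; exact ten_div_sqrt_le hq0 hNq le_rfl
        _ = (t + 29.75) / Real.sqrt q := by ring
        _ ≤ _ := by gcongr; norm_num
    · have hxs' := abs_le.1 hnear
      have hx2 : x ∉ shellSet N L t n s := fun h =>
        hx (Or.inr ⟨s, hsN, by linarith [hxI.1], by linarith [hxI.2], h⟩)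
      rw [shellSet, Set.mem_union, not_or] at hx2
      obtain ⟨hxsh, hxlast⟩ := hx2
      have hn : L / 2 ^ n < |x - s| := by
        by_contra! hle
        have := abs_le.1 hle
        exact hxlast ⟨by linarith, by linarith⟩
      obtain ⟨l, hl1, hl2⟩ := exists_nat_pow_near ((one_le_div hh).2 hnear)
        (by norm_num : (1 : ℝ) < 2)
      have hln : l < n := by
        by_contra! hle
        have h3 : (2 : ℝ) ^ n ≤ 2 ^ l := pow_le_pow_right₀ (by norm_num) hle
        rw [div_lt_iff₀ (by positivity)] at hn
        rw [le_div_iff₀ hh] at hl1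
        nlinarith
      have hll : ((l : ℝ) + 1) * Real.log 2 ≤ t := by
        have h3 : ((l + 1 : ℕ) : ℝ) * Real.log 2 ≤ t := by
          rw [← Real.log_pow, Real.log_le_iff_le_exp (by positivity)]
          exact (pow_le_pow_right₀ (by norm_num) hln).trans h1
        exact_mod_cast h3
      have hlin : |x - s| ≤ L / 2 ^ l := by
        rw [le_div_iff₀ hh] at hl1
        rw [le_div_iff₀ (by positivity)]
        linarith
      have hxl : x ∉ wellApproxSet (shellThreshold N l) (2 * (t - (l + 1) * Real.log 2)) := by
        intro h
        refine hxsh ?_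
        simp only [Set.mem_iUnion]
        have := abs_le.1 hlin
        exact ⟨l, Finset.mem_range.2 hln, h, by linarith, by linarith⟩
      have hthr : N ≤ shellThreshold N l := le_mul_of_one_le_right hN.le (le_max_left _ _)
      have hthr1 : shellThreshold N l * (2 * s.den * |x - s|) ≤ 1 := by
        rw [shellThreshold]
        rcases max_choice 1 (2 ^ l / (2 * thresholdConst ^ 2)) with h | h
        · rw [h, mul_one]; exact hclose
        · rw [h]
          calc N * (2 ^ l / (2 * thresholdConst ^ 2)) * (2 * s.den * |x - s|)
              ≤ N * (2 ^ l / (2 * thresholdConst ^ 2)) * (2 * N * (L / 2 ^ l)) := by gcongr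
            _ = (N ^ 2 * L) / thresholdConst ^ 2 := by field_simp
            _ = 1 := by rw [hNL]; field_simp
      refine (thetaMass_le_of_near (N' := shellThreshold N l) (by linarith) hY0 hY1 hNY hsN hxs hne
        (hN.trans_le hthr) hthr1 hxl).trans ?_
      have hlog : max 0 (Real.log (Y / |x - s|)) ≤ (l + 1) * Real.log 2 := by
        refine max_le (by positivity) ?_
        have h3 : ((l + 1 : ℕ) : ℝ) * Real.log 2 = Real.log (2 ^ (l + 1)) := (Real.log_pow _ _).symm
        push_cast at h3
        rw [h3]
        apply Real.log_le_log (by positivity)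
        calc Y / |x - s| ≤ L / |x - s| := by gcongr
          _ ≤ _ := hl2.le
      have hpos : 0 ≤ 3 + 2 * (2 * (t - (l + 1) * Real.log 2)) := by linarith
      have hlog0 : 0 ≤ 29 + max 0 (Real.log (Y / |x - s|)) := by positivity
      rw [← ENNReal.ofReal_add (by positivity) (by positivity)]
      apply ENNReal.ofReal_le_ofReal
      calc _ ≤ 1 / Real.sqrt q * (29 + (l + 1) * Real.log 2) +
            1 / 4 * (1 / Real.sqrt q) * (3 + 2 * (2 * (t - (l + 1) * Real.log 2))) := by
            gcongr; exact ten_div_sqrt_le hq0 hNq hthr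
        _ = (t + 29.75) / Real.sqrt q := by ring
        _ ≤ _ := by gcongr; norm_num

/-- The level sets of `thetaIntegral - c`, for a suitable constant `c`, on an interval of points
that are well approximated by `p/q`. -/
lemma exists_volume_level_le : ∃ C : ℝ, 0 < C ∧ ∀ (p q : ℕ), 0 < q → p.Coprime q →
    ∀ (G : Set ℝ) (u v : ℝ), u < v → G ⊆ Set.Icc u v → G.Nonempty →
    (∀ x ∈ G, Irrational x ∧ IsGoodApprox p q x ∧ ThetaIntegrable x) → v - u ≤ 2 / (q : ℝ) ^ 2 →
    ∃ c : ℂ, ∀ lam : ℝ, volume {x ∈ G | lam < ‖thetaIntegral x - c‖} ≤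
      ENNReal.ofReal (C * (v - u) * Real.exp (-(lam * Real.sqrt (2 * q)))) := by
  obtain ⟨C, hC0, hC⟩ := volume_exceptionalSet_le
  have hA := thresholdConst_pos
  have hA1 : 1 ≤ thresholdConst := by unfold thresholdConst; norm_num
  set D : ℝ := 2 * (9 * Real.log (4 * thresholdConst ^ 2) + 144) + 30 with hD
  have hlogA : 0 ≤ Real.log (4 * thresholdConst ^ 2) := Real.log_nonneg (by nlinarith)
  have hD0 : 0 ≤ D := by positivity
  refine ⟨(C + 1) * Real.exp D, by positivity, ?_⟩
  intro p q hq hpq G u v huv hGI hGne hG hLq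
  set L := v - u with hLdef
  have hL : 0 < L := by rw [hLdef]; linarith
  have hq0 : (0 : ℝ) < q := by exact_mod_cast hq
  have hq1 : (1 : ℝ) ≤ q := by exact_mod_cast hq
  have hsq : 0 < Real.sqrt q := by positivity
  have hs2 : 0 < Real.sqrt 2 := by positivity
  obtain ⟨x₀, hx₀⟩ := hGne
  refine ⟨thetaCenter x₀ L, fun lam => ?_⟩
  set Λ := lam * Real.sqrt (2 * q) with hΛ
  rcases lt_or_ge Λ D with hlt | hge
  · refine (measure_mono ((Set.sep_subset _ _).trans hGI)).trans ?_
    rw [Real.volume_Icc]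
    apply ENNReal.ofReal_le_ofReal
    have h1 : 1 ≤ Real.exp D * Real.exp (-Λ) := by
      rw [← Real.exp_add]; exact Real.one_le_exp (by linarith)
    calc L = L * 1 := (mul_one L).symm
      _ ≤ L * (Real.exp D * Real.exp (-Λ)) := by gcongr
      _ ≤ (C + 1) * (L * (Real.exp D * Real.exp (-Λ))) := le_mul_of_one_le_left (by positivity) (by linarith)
      _ = _ := by ring
  · set t := Λ - D with ht
    have ht0 : 0 ≤ t := by rw [ht]; linarith
    obtain ⟨n, hn1, hn2⟩ := exists_nat_two_pow_near_exp ht0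
    set N := thresholdConst / Real.sqrt L with hN
    have hsL : 0 < Real.sqrt L := by positivity
    have hN0 : 0 < N := by positivity
    have hNL : N ^ 2 * L = thresholdConst ^ 2 := by
      rw [hN, div_pow, Real.sq_sqrt hL.le]; field_simp
    have hNq : 1600 * (q : ℝ) ≤ N := by
      have e5 : Real.sqrt L ≤ 3 / 2 / q := by
        apply Real.sqrt_le_iff.2
        refine ⟨by positivity, hLq.trans ?_⟩
        rw [div_pow]
        gcongr
        norm_num
      rw [hN, le_div_iff₀ hsL]
      calc 1600 * (q : ℝ) * Real.sqrt L ≤ 1600 * (q : ℝ) * (3 / 2 / q) := by gcongr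
        _ = thresholdConst := by unfold thresholdConst; field_simp; norm_num
    have hL2 : L ≤ 2 := hLq.trans (by
      rw [div_le_iff₀ (by positivity)]; nlinarith)
    have hsub : {x ∈ G | lam < ‖thetaIntegral x - thetaCenter x₀ L‖} ⊆
        exceptionalSet N L t n u v := by
      rintro x ⟨hxG, hlam⟩
      by_contra hx
      obtain ⟨hirr, hgood, hint⟩ := hG x hxG
      obtain ⟨_, hgood₀, hint₀⟩ := hG x₀ hx₀
      have h1 := thetaMass_le_of_notMem_exceptionalSet hq hL hL2 hN0 hNL hNq ht0 hn1 (hGI hxG)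
        hirr hgood hx
      have hxx : |x - x₀| ≤ L := by
        have := hGI hxG
        have := hGI hx₀
        rw [abs_le]
        constructor <;> linarith [(hGI hxG).1, (hGI hxG).2, (hGI hx₀).1, (hGI hx₀).2]
      have hYL : L / (4 * thresholdConst ^ 2) ≤ L := div_le_self hL.le (by nlinarith)
      have h2 := enorm_thetaIntegral_sub_center_le (p := (p : ℤ)) (x := x) (x₀ := x₀) (L := L)
        (y₀ := L / (4 * thresholdConst ^ 2)) hq (by
          rw [Int.isCoprime_iff_nat_coprime]; simpa using hpq) (by positivity) hYL hLq
        (by simpa using hgood.1) (by simpa using hgood₀.1) hxx hint hint₀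
      have e1 : L / (L / (4 * thresholdConst ^ 2)) = 4 * thresholdConst ^ 2 := by field_simp
      rw [e1] at h2
      have h3 : ‖thetaIntegral x - thetaCenter x₀ L‖ₑ ≤ ENNReal.ofReal
          ((9 * Real.log (4 * thresholdConst ^ 2) + 144) / Real.sqrt q +
            1 / Real.sqrt 2 * ((t + 30) / Real.sqrt q)) := by
        rw [ENNReal.ofReal_add (by positivity) (by positivity),
          ENNReal.ofReal_mul (by positivity : 0 ≤ 1 / Real.sqrt 2)]
        exact h2.trans (by gcongr)
      rw [← ofReal_norm, ENNReal.ofReal_le_ofReal_iff (by positivity)] at h3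
      have h4 := hlam.trans_le h3
      have h5 : Λ < Λ := by
        calc Λ = lam * (Real.sqrt 2 * Real.sqrt q) := by rw [hΛ, Real.sqrt_mul (by norm_num)]
          _ < ((9 * Real.log (4 * thresholdConst ^ 2) + 144) / Real.sqrt q +
            1 / Real.sqrt 2 * ((t + 30) / Real.sqrt q)) * (Real.sqrt 2 * Real.sqrt q) := by gcongr
          _ = Real.sqrt 2 * (9 * Real.log (4 * thresholdConst ^ 2) + 144) + (t + 30) := by
            field_simp
          _ ≤ 2 * (9 * Real.log (4 * thresholdConst ^ 2) + 144) + (t + 30) := by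
            gcongr
            rw [Real.sqrt_le_left (by norm_num)]
            norm_num
          _ = Λ := by rw [ht, hD]; ring
      exact lt_irrefl _ h5
    refine (measure_mono hsub).trans ((hC N L t u v n hL hN0 hNL hLdef.symm ht0 hn1 hn2).trans ?_)
    apply ENNReal.ofReal_le_ofReal
    have e : Real.exp (-t) = Real.exp D * Real.exp (-Λ) := by
      rw [← Real.exp_add, ht]; ring_nf
    rw [e]
    have : 0 ≤ L * (Real.exp D * Real.exp (-Λ)) := by positivity
    nlinarith

/-! ### Averages -/

lemma volume_of_ordConnected {I : Set ℝ} {a b : ℝ} (hI : I.OrdConnected) (hab : I ⊆ Set.Icc a b)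
    (hne : I.Nonempty) :
    I ⊆ Set.Icc (sInf I) (sSup I) ∧ volume I = ENNReal.ofReal (sSup I - sInf I) ∧
      sInf I ≤ sSup I := by
  have hbb : BddBelow I := ⟨a, fun x hx => (hab hx).1⟩
  have hba : BddAbove I := ⟨b, fun x hx => (hab hx).2⟩
  have hsub : I ⊆ Set.Icc (sInf I) (sSup I) := fun x hx => ⟨csInf_le hbb hx, le_csSup hba hx⟩
  refine ⟨hsub, le_antisymm ?_ ?_, csInf_le_csSup hne hbb hba⟩
  · exact (measure_mono hsub).trans_eq Real.volume_Icc
  · rw [← Real.volume_Ioo]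
    refine measure_mono fun x hx => ?_
    obtain ⟨y, hy, hyx⟩ := exists_lt_of_csInf_lt hne hx.1
    obtain ⟨z, hz, hxz⟩ := exists_lt_of_lt_csSup hne hx.2
    exact hI.out hy hz ⟨hyx.le, hxz.le⟩

/-- An exponential bound for the level sets of `f - c` passes to the level sets of `f` minus its
average. -/
lemma volume_sub_average_le {I : Set ℝ} (hI : MeasurableSet I) {f : ℝ → ℂ} (hf : IntegrableOn f I)
    (h0 : volume I ≠ 0) (htop : volume I ≠ ⊤) {c : ℂ} {C κ : ℝ} (hC : 0 ≤ C) (hκ : 0 < κ)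
    (h : ∀ lam : ℝ, volume {x ∈ I | lam < ‖f x - c‖} ≤
      ENNReal.ofReal (C * Real.exp (-(lam * κ))) * volume I) (lam : ℝ) :
    volume {x ∈ I | lam < ‖f x - ⨍ y in I, f y‖} ≤
      ENNReal.ofReal (C * Real.exp C * Real.exp (-(lam * κ))) * volume I := by
  have hV : 0 < (volume I).toReal := ENNReal.toReal_pos h0 htop
  have hconst : IntegrableOn (fun _ : ℝ => c) I := integrableOn_const htop
  have hint : IntegrableOn (fun x => ‖f x - c‖) I := (hf.sub hconst).norm
  have e : ∀ s : ℝ, C * Real.exp (-(s * κ)) = C * Real.exp (-κ * s) := fun s => by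
    congr 2; ring
  have hexp : IntegrableOn (fun s : ℝ => C * Real.exp (-(s * κ))) (Set.Ioi 0) := by
    simp_rw [e]
    exact (integrableOn_exp_mul_Ioi (neg_lt_zero.2 hκ) 0).const_mul C
  have hexpval : ∫ s in Set.Ioi (0 : ℝ), C * Real.exp (-(s * κ)) = C / κ := by
    simp_rw [e]
    rw [integral_const_mul, integral_exp_mul_Ioi (neg_lt_zero.2 hκ)]
    simp
    field_simp
  have hlay : ∫⁻ x in I, ENNReal.ofReal ‖f x - c‖ ≤ ENNReal.ofReal (C / κ) * volume I := by
    rw [lintegral_eq_lintegral_meas_lt _ (Eventually.of_forall fun x => norm_nonneg _)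
      hint.aemeasurable]
    calc _ ≤ ∫⁻ s in Set.Ioi (0 : ℝ), ENNReal.ofReal (C * Real.exp (-(s * κ))) * volume I := by
          refine lintegral_mono fun s => ?_
          rw [Measure.restrict_apply' hI]
          refine le_trans (measure_mono ?_) (h s)
          rintro x ⟨hx1, hx2⟩
          exact ⟨hx2, hx1⟩
      _ = ENNReal.ofReal (C / κ) * volume I := by
          rw [lintegral_mul_const' _ _ htop, ← ofReal_integral_eq_lintegral_ofReal hexp, hexpval]
          exact Eventually.of_forall fun s => by positivity
  have havg : ‖(⨍ y in I, f y) - c‖ ≤ C / κ := by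
    have e : (⨍ y in I, f y) - c = ((volume I).toReal)⁻¹ • ∫ y in I, (f y - c) := by
      rw [integral_sub hf hconst, setIntegral_const, setAverage_eq, smul_sub, smul_smul]
      rw [measureReal_def, inv_mul_cancel₀ hV.ne', one_smul]
    have h1 : ‖∫ y in I, (f y - c)‖ ≤ C / κ * (volume I).toReal := by
      refine (norm_integral_le_integral_norm _).trans ?_
      rw [integral_eq_lintegral_of_nonneg_ae (Eventually.of_forall fun x => norm_nonneg _)
        hint.aestronglyMeasurable]
      refine (ENNReal.toReal_mono (by finiteness) hlay).trans ?_
      rw [ENNReal.toReal_mul, ENNReal.toReal_ofReal (by positivity)]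
    rw [e, norm_smul, norm_inv, Real.norm_of_nonneg hV.le]
    calc _ ≤ ((volume I).toReal)⁻¹ * (C / κ * (volume I).toReal) := by gcongr
      _ = C / κ := by field_simp
  have hsub : {x ∈ I | lam < ‖f x - ⨍ y in I, f y‖} ⊆ {x ∈ I | lam - C / κ < ‖f x - c‖} := by
    rintro x ⟨hxI, hx⟩
    refine ⟨hxI, ?_⟩
    have : ‖f x - ⨍ y in I, f y‖ ≤ ‖f x - c‖ + ‖(⨍ y in I, f y) - c‖ := by
      rw [show f x - ⨍ y in I, f y = (f x - c) - ((⨍ y in I, f y) - c) by ring]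
      exact norm_sub_le _ _
    linarith
  refine (measure_mono hsub).trans ((h _).trans (le_of_eq ?_))
  rw [mul_assoc C, ← Real.exp_add]
  congr 4
  field_simp
  ring

theorem proposition4 :
    -- `F` is well defined almost everywhere and integrable, so that the averages `F_I` make sense
    (∀ᵐ x : ℝ, ∃ l : ℂ, Tendsto (fun N : ℕ => squareSeriesPartial N x) atTop (𝓝 l)) ∧
    IntegrableOn squareSeries (Set.Ico (0 : ℝ) 1) ∧
    ∃ C : ℝ, 0 < C ∧
      ∀ (p q j : ℕ), 0 < q → Nat.Coprime p q →
      ∀ I : Set ℝ, I.OrdConnected → I ⊆ convergentInterval p q j →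
      ∀ lam : ℝ, 0 < lam →
        volume {x : ℝ | x ∈ I ∧ lam < ‖squareSeries x - ⨍ y in I, squareSeries y‖} ≤
          ENNReal.ofReal (C * Real.exp (-(lam * Real.sqrt (2 * (q : ℝ))))) * volume I := by
  refine ⟨ae_tendsto_squareSeriesPartial.mono fun x hx => ⟨_, hx.1⟩, integrableOn_squareSeries_Ico, ?_⟩
  obtain ⟨C, hC0, hC⟩ := exists_volume_level_le
  refine ⟨C * Real.exp C, by positivity, ?_⟩
  intro p q j hq hpq I hI hIp lam _
  have hq0 : (0 : ℝ) < q := by exact_mod_cast hq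
  rcases eq_or_ne (volume I) 0 with h0 | h0
  · refine (measure_mono (fun x hx => hx.1)).trans ?_
    rw [h0]
    exact zero_le
  have hne : I.Nonempty := nonempty_of_measure_ne_zero h0
  have hIco : I ⊆ Set.Ico (0 : ℝ) 1 := fun x hx => (hIp hx).1
  obtain ⟨hIcc, hvol, huv⟩ := volume_of_ordConnected hI (hIco.trans Set.Ico_subset_Icc_self) hne
  set u := sInf I with hu
  set v := sSup I with hv
  have huv' : u < v := by
    rcases huv.lt_or_eq with h | h
    · exact h
    · rw [hvol, h] at h0; simp at h0
  set G : Set ℝ := {x ∈ I | Irrational x ∧ ThetaIntegrable x ∧ squareSeries x = thetaIntegral x}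
    with hGdef
  have hae : ∀ᵐ x : ℝ, x ∈ I → x ∈ G := by
    filter_upwards [ae_tendsto_squareSeriesPartial, ae_squareSeries_eq_thetaIntegral,
      (Set.countable_range ((↑) : ℚ → ℝ)).ae_notMem volume] with x h1 h2 h3 hx
    exact ⟨hx, h3, h1.2, h2⟩
  have hGI : G ⊆ I := Set.sep_subset _ _
  have hGprop : ∀ x ∈ G, Irrational x ∧ IsGoodApprox p q x ∧ ThetaIntegrable x := fun x hx =>
    ⟨hx.2.1, isGoodApprox_of_mem_convergentInterval hq hpq hx.2.1 (hIp hx.1), hx.2.2.1⟩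
  have hGvol : volume I ≤ volume G := measure_mono_ae hae
  have hGne : G.Nonempty := nonempty_of_measure_ne_zero
    (ne_of_gt (lt_of_lt_of_le (pos_iff_ne_zero.2 h0) hGvol))
  have hLq : v - u ≤ 2 / (q : ℝ) ^ 2 := by
    have hsub : G ⊆ Set.Icc (p / q - 1 / (q : ℝ) ^ 2) (p / q + 1 / (q : ℝ) ^ 2) := fun x hx => by
      have := abs_le.1 (hGprop x hx).2.1.1
      constructor <;> linarith
    have h1 := hGvol.trans (measure_mono hsub)
    rw [hvol, Real.volume_Icc, ENNReal.ofReal_le_ofReal_iff] at h1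
    · refine h1.trans (le_of_eq ?_)
      ring
    · have : 0 < 1 / (q : ℝ) ^ 2 := by positivity
      linarith
  obtain ⟨c, hc⟩ := hC p q hq hpq G u v huv' (hGI.trans hIcc) hGne hGprop hLq
  refine volume_sub_average_le hI.measurableSet (integrableOn_squareSeries_Ico.mono_set hIco) h0
    (by rw [hvol]; exact ENNReal.ofReal_ne_top) hC0.le (by positivity) (c := c) (fun s => ?_) lam
  calc _ ≤ volume {x ∈ G | s < ‖thetaIntegral x - c‖} := by
        refine measure_mono_ae ?_
        filter_upwards [hae] with x hx
        rintro ⟨hxI, hxs⟩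
        have hxG := hx hxI
        refine ⟨hxG, ?_⟩
        rwa [← hxG.2.2.2]
    _ ≤ _ := hc s
    _ = _ := by
        rw [hvol, ← ENNReal.ofReal_mul (by positivity)]
        congr 1
        ring
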